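/- Let $\mathbb F_q$ be a finite field with $q$ elements, $A=\mathbb F_q[\theta]$, $k=\mathbb F_q(\theta)$, $v$ a finite place of $k$, $\mathbb C_v$ the completion of an algebraic closure of $k_v$ with its $v$-adic absolute value, and $\overline k$ the algebraic closure of $k$ in $\mathbb C_v$. Put $L_i=\prod_{j=1}^{i}(\theta-\theta^{q^j})$. *The $t$-module.* For $r\ge 1$, $\mathfrak s=(s_1,\dots,s_r)$ with integers $s_i\ge 1$, and $\mathbf u=(u_1,\dots,u_r)\in\mathbb C_v^r$, put $d_\ell=s_\ell+\cdots+s_r$ and $d=d_1+\cdots+d_r$. Let $\rho:\mathbb F_q[t]\to \mathrm{Mat}_d(\mathbb C_v[\tau])$ (where $\tau\alpha=\alpha^q\tau$) be the $\mathbb F_q$-algebra homomorphism with $\rho_t=\theta I_d+N+E\tau$, where $N$ is block diagonal with blocks the $d_\ell\times d_\ell$ nilpotent matrices with ones on the first superdiagonal, and $E$ is block upper triangular, the only nonzero entry of its $d_\ell\times d_m$ block $E[\ell m]$ ($\ell\le m$) being $(-1)^{m-\ell}\prod_{e=\ell}^{m-1}u_e$ in the lower left corner. This defines the $t$-module $G_{\mathfrak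 s,\mathbf u}$. Let $\exp_G$ be the unique series $I_d+\sum_{i\ge1}Q_i\tau^i$ with $\exp_G\circ\,\partial\rho_a=\rho_a\circ\exp_G$ for all $a\in\mathbb F_q[t]$, where $\partial$ takes the coefficient of $\tau^0$, and let $\log_G$ be its formal inverse. Let $\mathbf v_{\mathfrak s,\mathbf u}$ be the point whose $\ell$-th block ($d_\ell$ coordinates) is $(0,\dots,0,(-1)^{r-\ell}u_\ell\cdots u_r)^{\mathrm{tr}}$. *$v$-adic CMSPLs.* Suppose $|u_i|_v\le 1$ for all $i$. Write $\tilde{\mathfrak s}=(s_r,\dots,s_1)$, $\tilde{\mathbf u}=(u_r,\dots,u_1)$, $\tilde d_\ell=s_{r+1-\ell}+\cdots+s_1$. Call $a\in\mathbb F_q[t]$ admissible if $a\ne0$ and all coordinates of $\rho_a(\mathbf v_{\tilde{\mathfrak s},\tilde{\mathbf u}})$ (for $G=G_{\tilde{\mathfrak s},\tilde{\mathbf u}}$) have absolute value $<1$. Then $\mathrm{Li}^\star_{\mathfrak s}(\mathbf u)_v$ is defined as $\frac{(-1)^{r-1}}{a(\theta)}$ times the $\tilde d_1$-th coordinate of $\log_G(\rho_a(\mathbf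 v_{\tilde{\mathfrak s},\tilde{\mathbf u}}))$ for any admissible $a$ (such $a$ exist and the value does not depend on $a$). Put $\mathrm{Li}^\star_\varnothing=0$. For $1\le i\le r$ put $\mathfrak s_{(i)}=(s_1+\cdots+s_i,s_{i+1},\dots,s_r)$, and $\mathfrak s_{(r+1)}=\varnothing$. **Theorem.** Let $r\ge1$, $\mathfrak s\in\mathbb Z_{\ge1}^r$ and $\mathbf u\in(\overline k^\times)^r$ with $|u_i|_v\le1$ for all $i$. Let $a(t)\in\mathbb F_q[t]$ be nonzero such that all coordinates of $\rho_a(\mathbf v_{\tilde{\mathfrak s},\tilde{\mathbf u}})\in G_{\tilde{\mathfrak s},\tilde{\mathbf u}}$ have $v$-adic absolute value $<1$, and write $\rho_a(\mathbf v_{\tilde{\mathfrak s},\tilde{\mathbf u}})=(V_1,\dots,V_r)^{\mathrm{tr}}$, $V_m=(V_{m,1},\dots,V_{m,\tilde d_m})^{\mathrm{tr}}$. Then all $V_{m,j}$ lie in $\overline k$, and $$\mathrm{Li}^\star_{\mathfrak s}(\mathbf u)_v=\frac{(-1)^{r-1}}{a(\theta)}\sum_{m=1}^{r}\sum_{j=0}^{\tilde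 d_m-1}\sum_{\ell=0}^{j}(-1)^{j+\ell+m-1}\binom j\ell\theta^\ell\Big\{\mathrm{Li}^\star_{\mathfrak s_{(r+1-m)}}(\theta^{j-\ell}V_{m,\tilde d_m-j},u_{r+2-m},\dots,u_r)_v-\mathrm{Li}^\star_{\mathfrak s_{(r+2-m)}}(\theta^{j-\ell}V_{m,\tilde d_m-j}u_{r+2-m},u_{r+3-m},\dots,u_r)_v\Big\},$$ where for $m=1$ the second term in braces is $\mathrm{Li}^\star_\varnothing=0$. Moreover all arguments on the right lie in the convergent region: the first argument of each CMSPL there (of positive depth) has absolute value $<1$, the others have absolute value $\le1$, and the CMSPL is given by its convergent power series $$\mathrm{Li}^\star_{(s'_1,\dots,s'_n)}(z_1,\dots,z_n)_v=\sum_{i_1\ge\cdots\ge i_n\ge0}\frac{z_1^{q^{i_1}}\cdots z_n^{q^{i_n}}}{L_{i_1}^{s'_1}\cdots L_{i_n}^{s'_n}}.$$ -/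

import Mathlib

open Polynomial IsDedekindDomain

noncomputable section

set_option linter.unusedSectionVars false

/-! ## The field `ℂ_v` for a finite place `v` of `k = 𝔽_q(θ)` -/

namespace FunctionFieldPlace

variable {F : Type*} [Field F] [Fintype F] (v : HeightOneSpectrum F[X])

/-- `q_v`, the cardinality of the residue field `A / vA`, where `A = 𝔽_q[θ]`. -/
def residueCard : ℕ := Nat.card (F[X] ⧸ v.asIdeal)

instance finite_residue : Finite (F[X] ⧸ v.asIdeal) := by
  obtain ⟨g, hg⟩ := (IsPrincipalIdealRing.principal v.asIdeal).principal
  have hg0 : g ≠ 0 := by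
    rintro rfl
    exact v.ne_bot (by simpa using hg)
  have hg' : v.asIdeal = Ideal.span {g} := hg
  have hfin : Module.Finite F (AdjoinRoot g) := (AdjoinRoot.powerBasis hg0).finite
  have hfin' : Finite (AdjoinRoot g) := Module.finite_of_finite F
  exact Finite.of_equiv (AdjoinRoot g) (Ideal.quotEquivOfEq hg'.symm).toEquiv

theorem one_lt_residueCard : (1 : NNReal) < (residueCard v : NNReal) := by
  have : Nontrivial (F[X] ⧸ v.asIdeal) := Ideal.Quotient.nontrivial_iff.mpr v.isPrime.ne_top
  exact_mod_cast Finite.one_lt_card (α := F[X] ⧸ v.asIdeal)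

/-- `k_v`, the completion of `k = 𝔽_q(θ)` at `v`. -/
abbrev Kv := v.adicCompletion (RatFunc F)

/-- The absolute value on `k_v` is normalized so that a uniformizer has norm `q_v⁻¹`. -/
instance rankOneKv : (Valued.v : Valuation (Kv v) (WithZero (Multiplicative ℤ))).RankOne :=
  Valuation.IsRankOneDiscrete.rankOne _ (one_lt_residueCard v)

instance nontriviallyNormedFieldKv : NontriviallyNormedField (Kv v) :=
  Valued.toNontriviallyNormedField (Kv v) (WithZero (Multiplicative ℤ))

instance isUltrametricDistKv : IsUltrametricDist (Kv v) :=
  IsUltrametricDist.isUltrametricDist_of_isNonarchimedean_norm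
    (Valued.isNonarchimedean_norm (Kv v) (WithZero (Multiplicative ℤ)))

/-- An algebraic closure of `k_v`. -/
abbrev KvBar := AlgebraicClosure (Kv v)

/-- The unique extension of the absolute value of `k_v` to its algebraic closure. -/
instance normedFieldKvBar : NormedField (KvBar v) := spectralNorm.normedField (Kv v) (KvBar v)

/-- `ℂ_v`, the completion of an algebraic closure of `k_v`. -/
def Cv := UniformSpace.Completion (KvBar v)

instance normedFieldCv : NormedField (Cv v) :=
  inferInstanceAs (NormedField (UniformSpace.Completion (KvBar v)))

instance completeSpaceCv : CompleteSpace (Cv v) :=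
  inferInstanceAs (CompleteSpace (UniformSpace.Completion (KvBar v)))

/-- The inclusion of `k` in `ℂ_v`, through `k_v` and its algebraic closure. -/
def kToCv : RatFunc F →+* Cv v :=
  (UniformSpace.Completion.coeRingHom (α := KvBar v)).comp
    ((algebraMap (Kv v) (KvBar v)).comp (algebraMap (RatFunc F) (Kv v)))

instance algebraRatFuncCv : Algebra (RatFunc F) (Cv v) := (kToCv v).toAlgebra

instance algebraConstCv : Algebra F (Cv v) :=
  ((algebraMap (RatFunc F) (Cv v)).comp (algebraMap F (RatFunc F))).toAlgebra

/-- The element `θ` of `ℂ_v`. -/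
def theta : Cv v := algebraMap (RatFunc F) (Cv v) RatFunc.X

end FunctionFieldPlace

/-! ## The rings `Mat_d(K)[τ] ⊆ Mat_d(K)[[τ]]` with `τ α = α^q τ` -/

section Twisted

variable (F : Type*) [Field F] [Fintype F] (K : Type*) [Field K] [Algebra F K]
  (ι : Type*) [Fintype ι] [DecidableEq ι]

/-- Entrywise `q ^ i`-th power `M ↦ M^(i)` of matrices, `q = #F`. -/
def twistMat (i : ℕ) : Matrix ι ι K →ₐ[F] Matrix ι ι K :=
  (FiniteField.frobeniusAlgHom F K ^ i).mapMatrix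

variable {F K ι} in
theorem twistMat_apply (i : ℕ) (M : Matrix ι ι K) :
    twistMat F K ι i M = M.map (fun x => x ^ (Fintype.card F) ^ i) := by
  ext a b
  simp [twistMat, AlgHom.coe_pow, FiniteField.coe_frobeniusAlgHom, pow_iterate]

variable {F K ι} in
theorem twistMat_twistMat (i j : ℕ) (M : Matrix ι ι K) :
    twistMat F K ι i (twistMat F K ι j M) = twistMat F K ι (i + j) M := by
  ext a b
  simp [twistMat_apply, ← pow_mul, pow_add, mul_comm]

variable {F K ι} in
theorem twistMat_zero (M : Matrix ι ι K) : twistMat F K ι 0 M = M := by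
  ext a b
  simp [twistMat_apply]

/-- Formal series `∑ i, f i τ ^ i` with matrix coefficients. The polynomials in `τ`, that is
`Mat_d(K[τ])`, are the series with finitely many nonzero coefficients. -/
@[nolint unusedArguments]
def TwistedSeries (_F : Type*) (K : Type*) (ι : Type*) := ℕ → Matrix ι ι K

namespace TwistedSeries

variable {F K ι}

instance : AddCommGroup (TwistedSeries F K ι) := inferInstanceAs (AddCommGroup (ℕ → Matrix ι ι K))

@[ext] theorem ext {f g : TwistedSeries F K ι} (h : ∀ n, f n = g n) : f = g := funext h

/-- `(α τ ^ i) (β τ ^ j) = α β^(i) τ ^ (i + j)`. -/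
instance : Mul (TwistedSeries F K ι) :=
  ⟨fun f g n => ∑ p ∈ Finset.HasAntidiagonal.antidiagonal n, f p.1 * twistMat F K ι p.1 (g p.2)⟩

variable (F) in
/-- The constant series `M τ ^ 0`. -/
def const (M : Matrix ι ι K) : TwistedSeries F K ι := fun n => if n = 0 then M else 0

instance : One (TwistedSeries F K ι) := ⟨const F 1⟩

theorem zero_apply (n : ℕ) : (0 : TwistedSeries F K ι) n = 0 := rfl

theorem add_apply (f g : TwistedSeries F K ι) (n : ℕ) : (f + g) n = f n + g n := rfl

theorem one_apply (n : ℕ) : (1 : TwistedSeries F K ι) n = if n = 0 then 1 else 0 := rfl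

theorem mul_apply (f g : TwistedSeries F K ι) (n : ℕ) :
    (f * g) n = ∑ p ∈ Finset.HasAntidiagonal.antidiagonal n, f p.1 * twistMat F K ι p.1 (g p.2) := rfl

theorem const_apply (M : Matrix ι ι K) (n : ℕ) : const F M n = if n = 0 then M else 0 := rfl

theorem const_mul_apply (M : Matrix ι ι K) (f : TwistedSeries F K ι) (n : ℕ) :
    (const F M * f) n = M * f n := by
  rw [mul_apply, Finset.sum_eq_single (0, n)]
  · simp [const_apply, twistMat_zero]
  · rintro ⟨i, j⟩ hp hne
    have : i ≠ 0 := by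
      rintro rfl
      simp at hp
      simp [hp] at hne
    simp [const_apply, this]
  · simp

theorem mul_const_apply (M : Matrix ι ι K) (f : TwistedSeries F K ι) (n : ℕ) :
    (f * const F M) n = f n * twistMat F K ι n M := by
  rw [mul_apply, Finset.sum_eq_single (n, 0)]
  · simp [const_apply]
  · rintro ⟨i, j⟩ hp hne
    have : j ≠ 0 := by
      rintro rfl
      simp at hp
      simp [hp] at hne
    simp [const_apply, this]
  · simp

instance : Ring (TwistedSeries F K ι) where
  __ := (inferInstance : AddCommGroup (TwistedSeries F K ι))
  mul_assoc f g h := by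
    ext1 n
    simp only [mul_apply, map_sum, map_mul, Finset.sum_mul, Finset.mul_sum, twistMat_twistMat]
    simp only [Finset.sum_sigma']
    apply Finset.sum_nbij' (fun ⟨⟨_i, j⟩, ⟨k, l⟩⟩ ↦ ⟨(k, l + j), (l, j)⟩)
      (fun ⟨⟨i, _j⟩, ⟨k, l⟩⟩ ↦ ⟨(i + k, l), (i, k)⟩) <;>
      grind [mul_assoc, Finset.HasAntidiagonal.mem_antidiagonal]
  one_mul f := by
    ext1 n
    exact (const_mul_apply (F := F) 1 f n).trans (by simp)
  mul_one f := by
    ext1 n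
    exact (mul_const_apply (F := F) 1 f n).trans (by simp)
  left_distrib f g h := by
    ext1 n
    simp [mul_apply, add_apply, mul_add, Finset.sum_add_distrib]
  right_distrib f g h := by
    ext1 n
    simp [mul_apply, add_apply, add_mul, Finset.sum_add_distrib]
  zero_mul f := by
    ext1 n
    simp [mul_apply, zero_apply]
  mul_zero f := by
    ext1 n
    simp [mul_apply, zero_apply]

/-- Constant series form a copy of the matrix ring. -/
def constRingHom : Matrix ι ι K →+* TwistedSeries F K ι where
  toFun := const F
  map_one' := rfl
  map_mul' M M' := by
    ext1 n
    rw [const_mul_apply]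
    by_cases h : n = 0 <;> simp [const_apply, h]
  map_zero' := by
    ext1 n
    simp [const_apply, zero_apply]
  map_add' M M' := by
    ext1 n
    by_cases h : n = 0 <;> simp [const_apply, add_apply, h]

/-- The `q`-Frobenius fixes `F`, so that the series form an `F`-algebra. -/
instance : Algebra F (TwistedSeries F K ι) :=
  (constRingHom.comp (algebraMap F (Matrix ι ι K))).toAlgebra' (by
    intro c f
    ext1 n
    have h1 := const_mul_apply (F := F) (algebraMap F (Matrix ι ι K) c) f n
    have h2 := mul_const_apply (F := F) (algebraMap F (Matrix ι ι K) c) f n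
    rw [AlgHom.commutes] at h2
    exact h1.trans ((Algebra.commutes c (f n)).trans h2.symm))

/-- The value of `∑ i, f i τ ^ i` at a point `x` of `K ^ d`: the coordinatewise limit of
`∑ i, f i * x^(i)`. The sum is finite when `f` is a polynomial in `τ`. -/
def eval [TopologicalSpace K] (f : TwistedSeries F K ι) (x : ι → K) : ι → K :=
  fun b => ∑' n : ℕ, (f n).mulVec (fun c => x c ^ (Fintype.card F) ^ n) b

/-- The defining property of `exp_G` for the `t`-module given by `ρ`: it has constant term `1`, and
`exp_G ∘ ∂ρ_a = ρ_a ∘ exp_G` for all `a`. -/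
def IsExp (ρ : F[X] →ₐ[F] TwistedSeries F K ι) (f : TwistedSeries F K ι) : Prop :=
  f 0 = 1 ∧ ∀ a : F[X], f * const F (ρ a 0) = ρ a * f

/-- The exponential of the `t`-module given by `ρ`. -/
def exp (ρ : F[X] →ₐ[F] TwistedSeries F K ι) : TwistedSeries F K ι :=
  Classical.epsilon (IsExp ρ)

/-- The logarithm of the `t`-module given by `ρ`: the formal inverse of the exponential. -/
def log (ρ : F[X] →ₐ[F] TwistedSeries F K ι) : TwistedSeries F K ι :=
  Ring.inverse (exp ρ)

end TwistedSeries

end Twisted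

/-! ## The `t`-module `G_{s,u}` and its special point

Blocks are numbered `0, …, r - 1` and the entries of a block from `0`. -/

namespace CMSPL

section TModule

variable {r : ℕ} (s : Fin r → ℕ)

/-- `d_ℓ = s_ℓ + ⋯ + s_r`. -/
def blockDim (ℓ : Fin r) : ℕ := ∑ e ∈ Finset.Ici ℓ, s e

/-- Coordinates of `𝔾_a ^ d`, `d = d_1 + ⋯ + d_r`: a block and a position in it. -/
abbrev Idx := Σ ℓ : Fin r, Fin (blockDim s ℓ)

variable (F : Type*) [Field F] [Fintype F] {K : Type*} [Field K] [Algebra F K]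
  (θ : K) (u : Fin r → K)

/-- The block diagonal nilpotent matrix `N`. -/
def matN : Matrix (Idx s) (Idx s) K := fun x y =>
  if x.1 = y.1 ∧ (y.2 : ℕ) = x.2 + 1 then 1 else 0

/-- The block upper triangular matrix `E`. The block `E[ℓ m]`, `ℓ ≤ m`, has its only nonzero
entry in the lower left corner. -/
def matE : Matrix (Idx s) (Idx s) K := fun x y =>
  if x.1 ≤ y.1 ∧ (x.2 : ℕ) + 1 = blockDim s x.1 ∧ (y.2 : ℕ) = 0 then
    (-1) ^ ((y.1 : ℕ) - (x.1 : ℕ)) * ∏ e ∈ Finset.Ico x.1 y.1, u e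
  else 0

/-- `ρ_t = θ I_d + N + E τ`. -/
def rhoT : TwistedSeries F K (Idx s) := fun n =>
  if n = 0 then Matrix.scalar (Idx s) θ + matN s else if n = 1 then matE s u else 0

/-- The `t`-module `G_{s,u}`, `a ↦ ρ_a`. -/
def rho : F[X] →ₐ[F] TwistedSeries F K (Idx s) := Polynomial.aeval (rhoT s F θ u)

/-- The special point: the last entry of the block `ℓ` is `(-1)^(r-ℓ) u_ℓ ⋯ u_r`
(for `ℓ = 1, …, r`), the other entries are `0`. -/
def specialPoint : Idx s → K := fun x =>
  if (x.2 : ℕ) + 1 = blockDim s x.1 then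
    (-1) ^ (r - 1 - (x.1 : ℕ)) * ∏ e ∈ Finset.Ici x.1, u e
  else 0

/-- The `d_1`-th coordinate, that is the last one of the first block (`0` if there is none). -/
def lastOfFirstBlock (x : Idx s → K) : K :=
  if h : ∃ hr : 0 < r, 0 < blockDim s ⟨0, hr⟩ then
    x ⟨⟨0, h.1⟩, ⟨blockDim s ⟨0, h.1⟩ - 1, Nat.sub_lt h.2 Nat.one_pos⟩⟩
  else 0

end TModule

/-! ## Carlitz multiple star polylogarithms -/

section Li

variable (F : Type*) [Field F] [Fintype F] {K : Type*} [NormedField K] [Algebra F K] (θ : K)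
  {r : ℕ} (s : Fin r → ℕ) (u : Fin r → K)

/-- The point `ρ_a(v_{s̃,ũ})` of the `t`-module `G_{s̃,ũ}`, where `s̃ = (s_r, …, s_1)` and
`ũ = (u_r, …, u_1)`. -/
def rhoPoint (a : F[X]) : Idx (s ∘ Fin.rev) → K :=
  (rho (s ∘ Fin.rev) F θ (u ∘ Fin.rev) a).eval (specialPoint (s ∘ Fin.rev) (u ∘ Fin.rev))

/-- `a ≠ 0` and all coordinates of `ρ_a(v_{s̃,ũ})` lie in the maximal ideal. -/
def IsAdmissible (a : F[X]) : Prop := a ≠ 0 ∧ ∀ x, ‖rhoPoint F θ s u a x‖ < 1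

open Classical in
/-- The (analytically continued) value `Li⋆_s(u)`: for any admissible `a`, it is
`(-1)^(r-1) / a(θ)` times the `d̃_1`-th coordinate of `log (ρ_a(v_{s̃,ũ}))`, where `log` is the
logarithm of `G_{s̃,ũ}`. In depth `r = 0` it is `0`. -/
def Li : K :=
  if h : ∃ a : F[X], IsAdmissible F θ s u a then
    (-1) ^ (r - 1) / Polynomial.aeval θ h.choose *
      lastOfFirstBlock (s ∘ Fin.rev)
        ((TwistedSeries.log (rho (s ∘ Fin.rev) F θ (u ∘ Fin.rev))).eval
          (rhoPoint F θ s u h.choose))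
  else 0

/-- `L_i = (θ - θ^q) ⋯ (θ - θ^(q^i))`. -/
def bigL (i : ℕ) : K := ∏ j ∈ Finset.Icc 1 i, (θ - θ ^ (Fintype.card F) ^ j)

/-- The terms of the power series
`∑_{i_1 ≥ ⋯ ≥ i_r ≥ 0} u_1^(q^i_1) ⋯ u_r^(q^i_r) / (L_{i_1}^{s_1} ⋯ L_{i_r}^{s_r})`. -/
def liTerm (i : {i : Fin r → ℕ // Antitone i}) : K :=
  ∏ n, u n ^ (Fintype.card F) ^ (i.1 n) / bigL F θ (i.1 n) ^ s n

end Li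

section Tuples

variable {r : ℕ}

/-- The entry of a tuple at the position `i`, counted from `1` (`0` out of range). -/
def entry {α : Type*} [Zero α] (x : Fin r → α) (i : ℕ) : α :=
  if h : 1 ≤ i ∧ i ≤ r then x ⟨i - 1, by omega⟩ else 0

/-- `s_(i) = (s_1 + ⋯ + s_i, s_{i+1}, …, s_r)` for `1 ≤ i ≤ r`; it is empty for `i > r`. -/
def merged (s : Fin r → ℕ) (i : ℕ) : Fin (r + 1 - i) → ℕ := fun n =>
  if (n : ℕ) = 0 then ∑ e ∈ Finset.Icc 1 i, entry s e else entry s (i + n)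

/-- `(z, u_{i+1}, …, u_r)` for `1 ≤ i ≤ r`; it is empty for `i > r`. -/
def withHead {K : Type*} [Zero K] (z : K) (u : Fin r → K) (i : ℕ) : Fin (r + 1 - i) → K :=
  fun n => if (n : ℕ) = 0 then z else entry u (i + n)

end Tuples

end CMSPL

end

noncomputable section

set_option linter.unusedSectionVars false

open Filter Topology

/-! ### Inverses of twisted series; the exponential and the logarithm -/

namespace TwistedSeries

variable {F : Type*} [Field F] [Fintype F] {K : Type*} [Field K] [Algebra F K]
  {ι : Type*} [Fintype ι] [DecidableEq ι]

/-! Number the blocks from 0, as the code does. Comparing coefficients in `log_G ρ_t = (θ + N)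
log_G` gives a recursion for the coefficients of `log_G`. The row of `N` at the last coordinate of
the first block vanishes, so the corresponding row `p_k` of `log_G` satisfies a recursion of its
own, `p_{k+1} (θ^(q^(k+1)) + N) + p_k E^(k) = θ p_{k+1}`. It is solved explicitly in `logRow_eq`:
the entry of block `m` at distance `j` from its end is `(-1)^m (θ - θ^(q^k))^j / L_k^(d_m)` times a
nested sum over `k > i_m ≥ ⋯ ≥ i_1 ≥ 0`.

This row is evaluated at two kinds of points. At the special point the strict sums of all blocks
recombine into the nested sum with weak inequalities. Since `a = 1` is admissible when `|u_1| < 1`,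
this identifies `Li⋆` with its power series there (`hasSum_liTerm`). At a general point of the open
polydisc, the binomial theorem turns `(θ - θ^(q^k))^j z^(q^k)` into a combination of the powers
`(θ^(j-l) z)^(q^k)`, and a strict nested sum is a weak one minus its diagonal. The diagonal merges
one more exponent and one more variable into the head, whence the differences in braces
(`hasSum_Li_sub_Li`, `hasSum_logRow_mul_pow`).

Convergence rests on a lower bound for `|θ - θ^(q^n)|`, uniform in `n`, which holds because `X -
X^(q^n)` is squarefree: the coefficients grow at most geometrically while `x^(q^k)` decays doubly
exponentially. The functional equation then holds for values on the polydisc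
(`logSum_aeval_tAction`), so every admissible `a` gives the same value (`Li_eq_of_isAdmissible`), in
particular the given one. -/

theorem mul_apply_zero (f g : TwistedSeries F K ι) : (f * g) 0 = f 0 * g 0 := by
  simp [mul_apply, twistMat_zero]

/-- The coefficients of the right inverse of a series with constant term `1`. -/
def rightInvCoeff (f : TwistedSeries F K ι) : ℕ → Matrix ι ι K
  | 0 => 1
  | n + 1 => -∑ i : Fin (n + 1), f (i + 1) * twistMat F K ι (i + 1) (rightInvCoeff f (n - i))

/-- The right inverse of a series with constant term `1`. -/
def rightInv (f : TwistedSeries F K ι) : TwistedSeries F K ι := fun n => rightInvCoeff f n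

theorem rightInv_apply_zero (f : TwistedSeries F K ι) : rightInv f 0 = 1 := by
  rw [rightInv, rightInvCoeff]

theorem rightInv_apply_succ (f : TwistedSeries F K ι) (n : ℕ) :
    rightInv f (n + 1) =
      -∑ i ∈ Finset.range (n + 1), f (i + 1) * twistMat F K ι (i + 1) (rightInv f (n - i)) := by
  rw [Finset.sum_range, rightInv, rightInvCoeff]
  rfl

theorem exists_mul_eq_one {f : TwistedSeries F K ι} (hf : f 0 = 1) :
    ∃ g : TwistedSeries F K ι, g 0 = 1 ∧ f * g = 1 := by
  refine ⟨rightInv f, rightInv_apply_zero f, ?_⟩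
  ext1 n
  cases n with
  | zero => rw [mul_apply_zero, hf, rightInv_apply_zero, one_apply, if_pos rfl, mul_one]
  | succ n =>
    rw [mul_apply, Finset.Nat.sum_antidiagonal_succ, twistMat_zero, rightInv_apply_succ, hf,
      Finset.Nat.sum_antidiagonal_eq_sum_range_succ_mk, one_apply, if_neg n.succ_ne_zero, one_mul,
      neg_add_cancel]

/-- A right inverse again has constant term `1`, hence a right inverse of its own, which must be
`f`. -/
theorem isUnit_of_apply_zero {f : TwistedSeries F K ι} (hf : f 0 = 1) : IsUnit f := by
  obtain ⟨g, hg, hfg⟩ := exists_mul_eq_one hf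
  obtain ⟨h, -, hgh⟩ := exists_mul_eq_one hg
  have : f = h := by rw [← mul_one f, ← hgh, ← mul_assoc, hfg, one_mul]
  exact ⟨⟨f, g, hfg, by rw [this, hgh]⟩, rfl⟩

theorem algebraMap_eq_const (c : F) :
    algebraMap F (TwistedSeries F K ι) c = const F (algebraMap F (Matrix ι ι K) c) := rfl

theorem const_add (M M' : Matrix ι ι K) :
    const F (M + M') = (const F M + const F M' : TwistedSeries F K ι) :=
  constRingHom.map_add M M'

theorem const_mul (M M' : Matrix ι ι K) :
    const F (M * M') = (const F M * const F M' : TwistedSeries F K ι) :=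
  constRingHom.map_mul M M'

/-- To be the exponential of `ρ`, it suffices to satisfy the functional equation for `t`. -/
theorem isExp_of_X {ρ : F[X] →ₐ[F] TwistedSeries F K ι} {f : TwistedSeries F K ι}
    (h0 : f 0 = 1) (hX : f * const F (ρ X 0) = ρ X * f) : IsExp ρ f := by
  refine ⟨h0, fun a => ?_⟩
  induction a using Polynomial.induction_on with
  | C c =>
    rw [← Polynomial.algebraMap_eq, AlgHom.commutes, algebraMap_eq_const, const_apply, if_pos rfl,
      ← algebraMap_eq_const]
    exact (Algebra.commutes c f).symm
  | add a b ha hb => rw [map_add, add_apply, const_add, mul_add, add_mul, ha, hb]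
  | monomial n c h =>
    rw [pow_succ, ← mul_assoc, map_mul, mul_apply_zero, const_mul, ← mul_assoc, h, mul_assoc, hX,
      mul_assoc]

/-- The logarithm satisfies the functional equation as soon as the exponential exists. -/
theorem log_spec {ρ : F[X] →ₐ[F] TwistedSeries F K ι} (h : ∃ f, IsExp ρ f) :
    log ρ 0 = 1 ∧ ∀ a, log ρ * ρ a = const F (ρ a 0) * log ρ := by
  -- Existence is enough: uniqueness of the exponential is never needed, as the two properties
  -- proved here determine the row of the logarithm that is used.
  have he : IsExp ρ (exp ρ) := Classical.epsilon_spec h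
  have hu : IsUnit (exp ρ) := isUnit_of_apply_zero he.1
  have h1 : exp ρ * log ρ = 1 := Ring.mul_inverse_cancel _ hu
  have h2 : log ρ * exp ρ = 1 := Ring.inverse_mul_cancel _ hu
  constructor
  · have := congrFun h1 0
    rwa [mul_apply_zero, he.1, one_mul, one_apply, if_pos rfl] at this
  · intro a
    calc log ρ * ρ a = log ρ * (ρ a * exp ρ) * log ρ := by
          rw [mul_assoc, mul_assoc, h1, mul_one]
      _ = const F (ρ a 0) * log ρ := by rw [← he.2 a, ← mul_assoc, h2, one_mul]

end TwistedSeries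

/-- A Sylvester equation: `X ↦ (a - b) X + (X N - N X)` is an invertible scalar plus a commuting
nilpotent operator, hence bijective. -/
theorem Matrix.exists_mul_sub_mul_eq {K ι : Type*} [Field K] [Fintype ι] [DecidableEq ι]
    {N : Matrix ι ι K} (hN : IsNilpotent N) {a b : K} (hab : a ≠ b) (M : Matrix ι ι K) :
    ∃ X : Matrix ι ι K,
      X * (Matrix.scalar ι a + N) = (Matrix.scalar ι b + N) * X + M := by
  have hL := (LinearMap.isNilpotent_mulLeft_iff K N).mpr hN
  have hR := (LinearMap.isNilpotent_mulRight_iff K N).mpr hN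
  have hT : IsNilpotent (LinearMap.mulRight K N - LinearMap.mulLeft K N) :=
    (LinearMap.commute_mulLeft_right N N).symm.isNilpotent_sub hR hL
  have hu : IsUnit (algebraMap K (Module.End K (Matrix ι ι K)) (a - b)) :=
    (IsUnit.mk0 _ (sub_ne_zero.mpr hab)).map _
  have hu' := hT.isUnit_add_left_of_commute hu (Algebra.commutes _ _).symm
  obtain ⟨X, hX⟩ := ((Module.End.isUnit_iff _).mp hu').2 M
  refine ⟨X, ?_⟩
  have hX' : a • X - b • X + (X * N - N * X) = M := by
    rw [← sub_smul]
    exact hX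
  have h1 : X * Matrix.scalar ι a = a • X := by
    ext i j
    simp [mul_comm]
  have h2 : Matrix.scalar ι b * X = b • X := by
    ext i j
    simp
  rw [mul_add, add_mul, ← hX', h1, h2]
  abel

/-! ### Existence of `exp_G` and the recursion for `log_G` -/

namespace CMSPL

section TModule

variable {r : ℕ} (s : Fin r → ℕ)
variable {F : Type*} [Field F] [Fintype F] {K : Type*} [Field K] [Algebra F K]
  (θ : K) (u : Fin r → K)

theorem matN_pow_apply_eq_zero (n : ℕ) (x y : Idx s) (h : (y.2 : ℕ) < x.2 + n) :
    (matN s ^ n : Matrix (Idx s) (Idx s) K) x y = 0 := by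
  induction n generalizing y with
  | zero =>
    rw [pow_zero, Matrix.one_apply_ne]
    rintro rfl
    simp at h
  | succ n ih =>
    rw [pow_succ, Matrix.mul_apply]
    refine Finset.sum_eq_zero fun z _ => ?_
    by_cases hz : z.1 = y.1 ∧ (y.2 : ℕ) = z.2 + 1
    · rw [ih z (by omega), zero_mul]
    · rw [matN, if_neg hz, mul_zero]

theorem isNilpotent_matN : IsNilpotent (matN s : Matrix (Idx s) (Idx s) K) := by
  refine ⟨∑ e, s e, ?_⟩
  ext x y
  refine matN_pow_apply_eq_zero s _ x y ?_
  have h1 : blockDim s y.1 ≤ ∑ e, s e :=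
    Finset.sum_le_sum_of_subset (Finset.subset_univ _)
  have := y.2.2
  omega

theorem twistMat_scalar_add_matN (n : ℕ) :
    twistMat F K (Idx s) n (Matrix.scalar (Idx s) θ + matN s) =
      Matrix.scalar (Idx s) (θ ^ Fintype.card F ^ n) + matN s := by
  rw [map_add]
  congr 1
  · rw [twistMat_apply]
    ext x y
    by_cases h : x = y
    · simp [h]
    · simp [h, zero_pow, Fintype.card_ne_zero]
  · rw [twistMat_apply]
    ext x y
    by_cases h : x.1 = y.1 ∧ (y.2 : ℕ) = x.2 + 1
    · simp [matN, h]
    · simp [matN, h, zero_pow, Fintype.card_ne_zero]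

theorem rho_X : rho s F θ u X = rhoT s F θ u := aeval_X _

theorem rhoT_mul_apply_succ (g : TwistedSeries F K (Idx s)) (n : ℕ) :
    (rhoT s F θ u * g) (n + 1) =
      (Matrix.scalar (Idx s) θ + matN s) * g (n + 1) + matE s u * twistMat F K (Idx s) 1 (g n) := by
  rw [TwistedSeries.mul_apply, Finset.Nat.sum_antidiagonal_succ, twistMat_zero]
  congr 1
  rw [Finset.sum_eq_single (0, n)]
  · simp [rhoT]
  · rintro ⟨i, j⟩ hp hne
    have : i ≠ 0 := by
      rintro rfl
      simp at hp
      simp [hp] at hne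
    simp [rhoT, this]
  · simp

theorem mul_rhoT_apply_succ (g : TwistedSeries F K (Idx s)) (n : ℕ) :
    (g * rhoT s F θ u) (n + 1) =
      g (n + 1) * (Matrix.scalar (Idx s) (θ ^ Fintype.card F ^ (n + 1)) + matN s) +
        g n * twistMat F K (Idx s) n (matE s u) := by
  rw [TwistedSeries.mul_apply, Finset.Nat.sum_antidiagonal_succ', ← twistMat_scalar_add_matN]
  refine congrArg₂ (· + ·) rfl ?_
  rw [Finset.sum_eq_single (n, 0)]
  · simp [rhoT]
  · rintro ⟨i, j⟩ hp hne
    have : j ≠ 0 := by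
      rintro rfl
      simp at hp
      simp [hp] at hne
    simp [rhoT, this]
  · simp

/-- The coefficient of `τ^(n+1)` in the functional equation for `t` is a Sylvester equation with the
distinct scalars `θ^(q^(n+1))` and `θ`, so the coefficients can be chosen one after the other. -/
theorem exists_isExp_rho (hθ : ∀ n, n ≠ 0 → θ ^ Fintype.card F ^ n ≠ θ) :
    ∃ f, TwistedSeries.IsExp (rho s F θ u) f := by
  have key := fun (n : ℕ) (M : Matrix (Idx s) (Idx s) K) =>
    Matrix.exists_mul_sub_mul_eq (isNilpotent_matN s) (hθ (n + 1) n.succ_ne_zero) M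
  choose S hS using key
  let f : TwistedSeries F K (Idx s) := fun n =>
    Nat.rec 1 (fun n M => S n (matE s u * twistMat F K (Idx s) 1 M)) n
  refine ⟨f, TwistedSeries.isExp_of_X rfl ?_⟩
  rw [rho_X]
  ext1 n
  cases n with
  | zero =>
    rw [TwistedSeries.mul_apply_zero, TwistedSeries.mul_apply_zero, TwistedSeries.const_apply,
      if_pos rfl]
    change 1 * _ = _ * 1
    rw [one_mul, mul_one]
  | succ n =>
    rw [TwistedSeries.mul_const_apply, rhoT_mul_apply_succ]
    have : rhoT s F θ u 0 = Matrix.scalar (Idx s) θ + matN s := rfl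
    rw [this, twistMat_scalar_add_matN]
    exact hS n _

theorem log_rho_apply_zero (hθ : ∀ n, n ≠ 0 → θ ^ Fintype.card F ^ n ≠ θ) :
    TwistedSeries.log (rho s F θ u) 0 = 1 :=
  (TwistedSeries.log_spec (exists_isExp_rho s θ u hθ)).1

theorem log_rho_apply_succ (hθ : ∀ n, n ≠ 0 → θ ^ Fintype.card F ^ n ≠ θ) (n : ℕ) :
    TwistedSeries.log (rho s F θ u) (n + 1) *
        (Matrix.scalar (Idx s) (θ ^ Fintype.card F ^ (n + 1)) + matN s) +
      TwistedSeries.log (rho s F θ u) n * twistMat F K (Idx s) n (matE s u) =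
    (Matrix.scalar (Idx s) θ + matN s) * TwistedSeries.log (rho s F θ u) (n + 1) := by
  have h := congrFun ((TwistedSeries.log_spec (exists_isExp_rho s θ u hθ)).2 X) (n + 1)
  rw [rho_X, mul_rhoT_apply_succ, TwistedSeries.const_mul_apply] at h
  exact h

end TModule

end CMSPL

theorem FiniteField.frobeniusAlgHom_pow_apply (F : Type*) [Field F] [Fintype F] {K : Type*}
    [CommRing K] [Algebra F K] (n : ℕ) (x : K) :
    (FiniteField.frobeniusAlgHom F K ^ n) x = x ^ Fintype.card F ^ n := by
  simp [AlgHom.coe_pow, FiniteField.coe_frobeniusAlgHom, pow_iterate]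

theorem FiniteField.neg_one_pow_pow_card (F : Type*) [Field F] [Fintype F] {K : Type*}
    [CommRing K] [Algebra F K] (n k : ℕ) :
    ((-1 : K) ^ n) ^ Fintype.card F ^ k = (-1) ^ n := by
  rw [← FiniteField.frobeniusAlgHom_pow_apply F k, map_pow, map_neg, map_one]

namespace CMSPL

/-! ### Nested sums with weak and strict first inequality -/

section NestedSum

variable {K : Type*} [CommRing K] (g : ℕ → ℕ → K)

/-- The nested sum `∑_{k ≥ j_m ≥ ⋯ ≥ j_1 ≥ 0} g_{m-1}(j_m) ⋯ g_0(j_1)`. -/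
def nestedSum (k : ℕ) : ℕ → K
  | 0 => 1
  | m + 1 => ∑ j : Fin (k + 1), g m j * nestedSum j m

/-- The nested sum over `k > j_m ≥ ⋯ ≥ j_1 ≥ 0`. -/
def strictNestedSum : ℕ → ℕ → K
  | 0, m => if m = 0 then 1 else 0
  | k + 1, m => nestedSum g k m

theorem nestedSum_succ (k m : ℕ) :
    nestedSum g k (m + 1) = ∑ j ∈ Finset.range (k + 1), g m j * nestedSum g j m := by
  rw [Finset.sum_range, nestedSum]

theorem nestedSum_zero (k : ℕ) : nestedSum g k 0 = 1 := by rw [nestedSum]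

theorem strictNestedSum_zero (k : ℕ) : strictNestedSum g k 0 = 1 := by
  cases k with
  | zero => simp [strictNestedSum]
  | succ k => rw [strictNestedSum, nestedSum_zero]

theorem nestedSum_succ_eq_add (k m : ℕ) :
    nestedSum g k (m + 1) = strictNestedSum g k (m + 1) + g m k * nestedSum g k m := by
  rw [nestedSum_succ]
  cases k with
  | zero => simp [strictNestedSum]
  | succ k => rw [Finset.sum_range_succ, strictNestedSum, nestedSum_succ]

/-- Sort the terms by the number `l` of indices smaller than `k`: the remaining `m - l` indices all
equal `k`. -/
theorem nestedSum_eq_sum (k m : ℕ) :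
    nestedSum g k m =
      ∑ l ∈ Finset.range (m + 1), strictNestedSum g k l * ∏ e ∈ Finset.Ico l m, g e k := by
  induction m with
  | zero => simp [nestedSum_zero, strictNestedSum_zero]
  | succ m ih =>
    rw [nestedSum_succ_eq_add, Finset.sum_range_succ, Finset.Ico_self, Finset.prod_empty, mul_one,
      add_comm, ih, Finset.mul_sum]
    congr 1
    refine Finset.sum_congr rfl fun l hl => ?_
    rw [Finset.prod_Ico_succ_top (by simpa using Nat.lt_succ_iff.mp (Finset.mem_range.mp hl))]
    ring

theorem nestedSum_congr {g g' : ℕ → ℕ → K} {m : ℕ} (h : ∀ e < m, g e = g' e) (k : ℕ) :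
    nestedSum g k m = nestedSum g' k m := by
  induction m generalizing k with
  | zero => rw [nestedSum_zero, nestedSum_zero]
  | succ m ih =>
    rw [nestedSum_succ, nestedSum_succ]
    exact Finset.sum_congr rfl fun j _ => by
      rw [h m m.lt_succ_self, ih fun e he => h e (he.trans m.lt_succ_self)]

end NestedSum

section Entry

variable {r : ℕ}

theorem entry_val_add_one {α : Type*} [Zero α] (x : Fin r → α) (e : Fin r) :
    entry x (e + 1) = x e := by
  rw [entry, dif_pos (by omega)]
  rfl

theorem prod_Ico_eq_prod_entry {K : Type*} [CommSemiring K] (u : Fin r → K) (l m : Fin r) :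
    ∏ e ∈ Finset.Ico l m, u e = ∏ e ∈ Finset.Ico (l : ℕ) m, entry u (e + 1) := by
  rw [← Fin.map_valEmbedding_Ico, Finset.prod_map]
  exact Finset.prod_congr rfl fun e _ => (entry_val_add_one u e).symm

theorem prod_Ici_eq_prod_entry {K : Type*} [CommSemiring K] (u : Fin r → K) (l : Fin r) :
    ∏ e ∈ Finset.Ici l, u e = ∏ e ∈ Finset.Ico (l : ℕ) r, entry u (e + 1) := by
  rw [← Fin.map_valEmbedding_Ici, Finset.prod_map]
  exact Finset.prod_congr rfl fun e _ => (entry_val_add_one u e).symm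

theorem blockDim_eq_sum_entry (s : Fin r → ℕ) (l : Fin r) :
    blockDim s l = ∑ e ∈ Finset.Ico (l : ℕ) r, entry s (e + 1) := by
  rw [blockDim, ← Fin.map_valEmbedding_Ici, Finset.sum_map]
  exact Finset.sum_congr rfl fun e _ => (entry_val_add_one s e).symm

theorem blockDim_eq_add (s : Fin r → ℕ) {l m : Fin r} (h : l ≤ m) :
    blockDim s l = ∑ e ∈ Finset.Ico (l : ℕ) m, entry s (e + 1) + blockDim s m := by
  rw [blockDim_eq_sum_entry, blockDim_eq_sum_entry,
    Finset.sum_Ico_consecutive _ (by exact h) m.2.le]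

theorem blockDim_pos {s : Fin r → ℕ} (hs : ∀ i, 0 < s i) (l : Fin r) : 0 < blockDim s l :=
  Finset.sum_pos (fun i _ => hs i) ⟨l, by simp⟩

end Entry

/-! ### Closed form of the relevant row of `log_G` -/

section LogRow

variable (F : Type*) [Field F] [Fintype F] {K : Type*} [NormedField K] [Algebra F K] (θ : K)

/-- `w_e ^ (q ^ k) / L_k ^ σ_e`. -/
def liFactor (w : ℕ → K) (σ : ℕ → ℕ) (e k : ℕ) : K :=
  w e ^ Fintype.card F ^ k / bigL F θ k ^ σ e

theorem bigL_zero : bigL F θ 0 = 1 := by simp [bigL]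

theorem bigL_succ (k : ℕ) :
    bigL F θ (k + 1) = bigL F θ k * (θ - θ ^ Fintype.card F ^ (k + 1)) := by
  rw [bigL, bigL, Finset.prod_Icc_succ_top (by omega)]

variable {F θ} in
theorem bigL_ne_zero (hθ : ∀ n, n ≠ 0 → θ ^ Fintype.card F ^ n ≠ θ) (k : ℕ) : bigL F θ k ≠ 0 :=
  Finset.prod_ne_zero_iff.mpr fun n hn =>
    sub_ne_zero.mpr (hθ n (by have := (Finset.mem_Icc.mp hn).1; omega)).symm

variable {r : ℕ} (s : Fin r → ℕ) (u : Fin r → K)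

/-- The row of index `x₀` of the coefficients of `log_G`. -/
def logRow (x₀ : Idx s) (k : ℕ) (x : Idx s) : K := TwistedSeries.log (rho s F θ u) k x₀ x

variable {F θ s} {x₀ : Idx s}

theorem logRow_zero (hθ : ∀ n, n ≠ 0 → θ ^ Fintype.card F ^ n ≠ θ) (x : Idx s) :
    logRow F θ s u x₀ 0 x = if x₀ = x then 1 else 0 := by
  rw [logRow, log_rho_apply_zero s θ u hθ, Matrix.one_apply]

/-- This is why the row decouples: in row `x₀`, left multiplication by `θ + N` is multiplication by
`θ`. -/
theorem matN_apply_of_last (h : (x₀.2 : ℕ) + 1 = blockDim s x₀.1) (x : Idx s) :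
    (matN s : Matrix (Idx s) (Idx s) K) x₀ x = 0 := by
  rw [matN, if_neg]
  rintro ⟨h1, h2⟩
  have h3 := x.2.2
  have h4 : blockDim s x.1 = blockDim s x₀.1 := by rw [h1]
  omega

theorem logRow_succ (hθ : ∀ n, n ≠ 0 → θ ^ Fintype.card F ^ n ≠ θ)
    (hx₀ : (x₀.2 : ℕ) + 1 = blockDim s x₀.1) (k : ℕ) (x : Idx s) :
    logRow F θ s u x₀ (k + 1) x * θ ^ Fintype.card F ^ (k + 1) +
        ∑ z, logRow F θ s u x₀ (k + 1) z * matN s z x +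
        ∑ z, logRow F θ s u x₀ k z * matE s u z x ^ Fintype.card F ^ k =
      θ * logRow F θ s u x₀ (k + 1) x := by
  have h := congrFun (congrFun (log_rho_apply_succ s θ u hθ k) x₀) x
  rw [mul_add, add_mul, Matrix.add_apply, Matrix.add_apply, Matrix.add_apply, Matrix.mul_apply,
    Matrix.mul_apply, Matrix.mul_apply, Matrix.mul_apply (M := matN s)] at h
  simp only [matN_apply_of_last hx₀, zero_mul, Finset.sum_const_zero, add_zero] at h
  simpa [Matrix.mul_apply, Matrix.diagonal_apply, twistMat_apply, logRow] using h

theorem sum_mul_matN_of_eq_zero (p : Idx s → K) (m : Fin r) (h : 0 < blockDim s m) :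
    ∑ z, p z * matN s z ⟨m, ⟨0, h⟩⟩ = 0 :=
  Finset.sum_eq_zero fun z _ => by rw [matN, if_neg (by simp), mul_zero]

theorem sum_mul_matN_succ (p : Idx s → K) (m : Fin r) (j : ℕ) (h : j + 1 < blockDim s m) :
    ∑ z, p z * matN s z ⟨m, ⟨j + 1, h⟩⟩ = p ⟨m, ⟨j, by omega⟩⟩ := by
  rw [Finset.sum_eq_single ⟨m, ⟨j, by omega⟩⟩]
  · simp [matN]
  · rintro ⟨l, i⟩ - hne
    rw [matN, if_neg, mul_zero]
    rintro ⟨h1, h2⟩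
    dsimp only at h1 h2
    subst h1
    apply hne
    congr 1
    ext
    simp at h2
    simp [h2]
  · simp

theorem sum_mul_matE_succ (p : Idx s → K) (x : Idx s) (h : (x.2 : ℕ) ≠ 0) (k : ℕ) :
    ∑ z, p z * matE s u z x ^ Fintype.card F ^ k = 0 :=
  Finset.sum_eq_zero fun z _ => by
    rw [matE, if_neg (by simp [h]), zero_pow (by positivity), mul_zero]

theorem sum_mul_matE_zero (hd : ∀ l, 0 < blockDim s l) (p : Idx s → K) (m : Fin r) (k : ℕ) :
    ∑ z, p z * matE s u z ⟨m, ⟨0, hd m⟩⟩ ^ Fintype.card F ^ k =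
      ∑ l : Fin r, if l ≤ m then
        p ⟨l, ⟨blockDim s l - 1, by have := hd l; omega⟩⟩ * ((-1) ^ ((m : ℕ) - l) *
          ∏ e ∈ Finset.Ico (l : ℕ) m, entry u (e + 1) ^ Fintype.card F ^ k) else 0 := by
  rw [Fintype.sum_sigma]
  refine Finset.sum_congr rfl fun l _ => ?_
  have := hd l
  rw [Finset.sum_eq_single ⟨blockDim s l - 1, by omega⟩]
  · by_cases h : l ≤ m
    · rw [matE, if_pos ⟨h, by dsimp only; omega, rfl⟩, if_pos h, mul_pow,
        FiniteField.neg_one_pow_pow_card, prod_Ico_eq_prod_entry, Finset.prod_pow]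
    · rw [matE, if_neg (fun h' => h h'.1), if_neg h, zero_pow (by positivity), mul_zero]
  · intro i _ hne
    rw [matE, if_neg, zero_pow (by positivity), mul_zero]
    rintro ⟨-, h1, -⟩
    apply hne
    ext
    dsimp only at h1 ⊢
    omega
  · simp

/-- The closed form of the last row of the first block of the coefficients of `log_G`. -/
theorem logRow_eq (hθ : ∀ n, n ≠ 0 → θ ^ Fintype.card F ^ n ≠ θ) (hd : ∀ l, 0 < blockDim s l)
    (hx₀ : (x₀.2 : ℕ) + 1 = blockDim s x₀.1) (hx₀' : (x₀.1 : ℕ) = 0) (k : ℕ) (m : Fin r)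
    (j : Fin (blockDim s m)) :
    logRow F θ s u x₀ k ⟨m, j⟩ =
      (-1) ^ (m : ℕ) * (θ - θ ^ Fintype.card F ^ k) ^ (j.rev : ℕ) / bigL F θ k ^ blockDim s m *
        strictNestedSum (liFactor F θ (fun e => entry u (e + 1)) fun e => entry s (e + 1)) k m := by
  obtain ⟨m₀, j₀⟩ := x₀
  induction k generalizing m j with
  | zero =>
    -- At `k = 0` the base `θ - θ^(q^0)` is `0`, so its power is `1` at the end of a block and `0`
    -- elsewhere, while the strict sum kills every block but the first.
    rw [logRow_zero u hθ, pow_zero, pow_one, sub_self, bigL_zero, one_pow, div_one,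
      strictNestedSum]
    by_cases hm : (m : ℕ) = 0
    · obtain rfl : m₀ = m := Fin.ext (by rw [hm]; exact hx₀')
      rw [hm, pow_zero, one_mul, if_pos rfl, mul_one, Fin.val_rev]
      dsimp only at hx₀
      by_cases hj : j₀ = j
      · subst hj
        rw [if_pos rfl, hx₀, Nat.sub_self, pow_zero]
      · rw [if_neg (by simpa using hj), zero_pow]
        intro h
        exact hj (Fin.ext (by omega))
    · rw [if_neg hm, mul_zero, if_neg]
      rintro ⟨⟩
      exact hm hx₀'
  | succ k ih =>
    set L := bigL F θ k with hL
    set lam := θ - θ ^ Fintype.card F ^ (k + 1) with hlam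
    have hL0 : L ≠ 0 := bigL_ne_zero hθ k
    have hlam0 : lam ≠ 0 := sub_ne_zero.mpr (hθ _ k.succ_ne_zero).symm
    set g := liFactor F θ (fun e => entry u (e + 1)) (fun e => entry s (e + 1)) with hg
    -- `E` only sees the last entries of the blocks `l ≤ m`, where the power of `θ - θ^(q^k)` is
    -- trivial. Splitting `d_l` as `s_l + ⋯ + s_{m-1} + d_m`, the sum over `l` becomes the
    -- decomposition `nestedSum_eq_sum`.
    have hb : ∑ z, logRow F θ s u ⟨m₀, j₀⟩ k z * matE s u z ⟨m, ⟨0, hd m⟩⟩ ^ Fintype.card F ^ k =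
        (-1) ^ (m : ℕ) / L ^ blockDim s m * nestedSum g k m := by
      rw [sum_mul_matE_zero u hd]
      have hterm : ∀ l : Fin r, (if l ≤ m then
          logRow F θ s u ⟨m₀, j₀⟩ k ⟨l, ⟨blockDim s l - 1, by have := hd l; omega⟩⟩ *
            ((-1) ^ ((m : ℕ) - l) *
              ∏ e ∈ Finset.Ico (l : ℕ) m, entry u (e + 1) ^ Fintype.card F ^ k) else 0) =
          (fun i : ℕ => if i ≤ (m : ℕ) then (-1) ^ (m : ℕ) / L ^ blockDim s m *
            (strictNestedSum g k i * ∏ e ∈ Finset.Ico i m, g e k) else 0) l := by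
        intro l
        by_cases h : l ≤ m
        · have h' : (l : ℕ) ≤ m := h
          have hrev : ((⟨blockDim s l - 1, by have := hd l; omega⟩ : Fin (blockDim s l)).rev : ℕ)
              = 0 := by
            rw [Fin.val_rev]
            have := hd l
            dsimp only
            omega
          have hprod : ∏ e ∈ Finset.Ico (l : ℕ) m, g e k =
              (∏ e ∈ Finset.Ico (l : ℕ) m, entry u (e + 1) ^ Fintype.card F ^ k) /
                L ^ ∑ e ∈ Finset.Ico (l : ℕ) m, entry s (e + 1) := by
            simp only [hg, liFactor]
            rw [Finset.prod_div_distrib, Finset.prod_pow_eq_pow_sum]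
          have hsign : (-1 : K) ^ (m : ℕ) = (-1) ^ (l : ℕ) * (-1) ^ ((m : ℕ) - l) := by
            rw [← pow_add, Nat.add_sub_cancel' h']
          dsimp only
          rw [if_pos h, if_pos h', ih, hrev, pow_zero, mul_one, hprod, blockDim_eq_add s h, pow_add,
            hsign]
          field_simp
        · have h' : ¬(l : ℕ) ≤ m := h
          dsimp only
          rw [if_neg h, if_neg h']
      rw [Finset.sum_congr rfl fun l _ => hterm l, Fin.sum_univ_eq_sum_range
        (fun i : ℕ => if i ≤ (m : ℕ) then (-1) ^ (m : ℕ) / L ^ blockDim s m *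
            (strictNestedSum g k i * ∏ e ∈ Finset.Ico i m, g e k) else 0) r, nestedSum_eq_sum,
        Finset.mul_sum]
      symm
      have hsub : Finset.range ((m : ℕ) + 1) ⊆ Finset.range r :=
        Finset.range_subset_range.mpr m.2
      rw [← Finset.sum_subset hsub]
      · refine Finset.sum_congr rfl fun i hi => ?_
        rw [if_pos (Nat.lt_succ_iff.mp (Finset.mem_range.mp hi))]
      · intro i _ hi
        rw [if_neg fun h => hi (Finset.mem_range.mpr (Nat.lt_succ_of_le h))]
    obtain ⟨j, hj⟩ := j
    -- Inside a block `E` feeds only the first entry; `N` then carries each entry to the next one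
    -- with a further division by `θ - θ^(q^(k+1))`.
    have hclosed : logRow F θ s u ⟨m₀, j₀⟩ (k + 1) ⟨m, ⟨j, hj⟩⟩ =
        (-1) ^ (m : ℕ) / L ^ blockDim s m * nestedSum g k m / lam ^ (j + 1) := by
      induction j with
      | zero =>
        have h := logRow_succ u hθ hx₀ k ⟨m, ⟨0, hj⟩⟩
        rw [sum_mul_matN_of_eq_zero, hb, add_zero] at h
        rw [zero_add, pow_one, eq_div_iff hlam0, hlam]
        linear_combination -h
      | succ j ihj =>
        have h := logRow_succ u hθ hx₀ k ⟨m, ⟨j + 1, hj⟩⟩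
        rw [sum_mul_matN_succ, sum_mul_matE_succ u _ _ (by simp), ihj (by omega), add_zero] at h
        rw [pow_succ, ← div_div, eq_div_iff hlam0, hlam]
        linear_combination -h
    rw [hclosed, strictNestedSum, bigL_succ, ← hlam, ← hL, mul_pow]
    have hpow : lam ^ blockDim s m =
        lam ^ ((⟨j, hj⟩ : Fin (blockDim s m)).rev : ℕ) * lam ^ (j + 1) := by
      rw [← pow_add, Fin.val_rev]
      congr 1
      dsimp only
      omega
    rw [hpow]
    field_simp

end LogRow

end CMSPL

/-! ### The norm of `ℂ_v` and the size of `θ - θ^(q^n)` -/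

namespace FunctionFieldPlace

variable {F : Type*} [Field F] [Fintype F] (v : HeightOneSpectrum F[X])

instance isUltrametricDistCv : IsUltrametricDist (Cv v) := by
  refine IsUltrametricDist.isUltrametricDist_of_isNonarchimedean_norm fun x y => ?_
  refine UniformSpace.Completion.induction_on₂ (p := fun x y : UniformSpace.Completion (KvBar v) =>
    ‖x + y‖ ≤ max ‖x‖ ‖y‖) x y (isClosed_le (by fun_prop) (by fun_prop)) fun a b => ?_
  rw [← UniformSpace.Completion.coe_add, UniformSpace.Completion.norm_coe,
    UniformSpace.Completion.norm_coe, UniformSpace.Completion.norm_coe]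
  exact isNonarchimedean_spectralNorm (K := Kv v) (L := KvBar v) a b

theorem norm_algebraMap_Cv (x : RatFunc F) :
    ‖algebraMap (RatFunc F) (Cv v) x‖ = ‖algebraMap (RatFunc F) (Kv v) x‖ := by
  change ‖((algebraMap (Kv v) (KvBar v) (algebraMap (RatFunc F) (Kv v) x) : KvBar v) :
    UniformSpace.Completion (KvBar v))‖ = _
  rw [UniformSpace.Completion.norm_coe]
  exact spectralNorm_extends (L := KvBar v) (algebraMap (RatFunc F) (Kv v) x)

theorem norm_algebraMap_Cv_le_iff (x y : RatFunc F) :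
    ‖algebraMap (RatFunc F) (Cv v) x‖ ≤ ‖algebraMap (RatFunc F) (Cv v) y‖ ↔
      v.valuation (RatFunc F) x ≤ v.valuation (RatFunc F) y := by
  rw [norm_algebraMap_Cv, norm_algebraMap_Cv, Valued.toNormedField.norm_le_iff]
  have h := fun x : RatFunc F =>
    HeightOneSpectrum.valuedAdicCompletion_eq_valuation' v x
  rw [← h x, ← h y]
  rfl

instance isScalarTower_Cv : IsScalarTower F (RatFunc F) (Cv v) := IsScalarTower.of_algebraMap_eq' rfl

theorem aeval_theta (a : F[X]) :
    aeval (theta v) a = algebraMap (RatFunc F) (Cv v) (algebraMap F[X] (RatFunc F) a) := by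
  rw [theta, aeval_algebraMap_apply]
  congr 1
  rw [← RatFunc.algebraMap_X, aeval_algebraMap_apply, aeval_X_left_apply]

theorem norm_theta_le_one : ‖theta v‖ ≤ 1 := by
  have h := (norm_algebraMap_Cv_le_iff v RatFunc.X 1).mpr ?_
  · rwa [map_one, norm_one] at h
  · rw [map_one, ← RatFunc.algebraMap_X]
    exact HeightOneSpectrum.valuation_le_one v X

theorem transcendental_theta : Transcendental F (theta v) := by
  rw [transcendental_iff]
  intro p hp
  rw [aeval_theta, map_eq_zero] at hp
  exact (map_eq_zero_iff _ (IsFractionRing.injective F[X] (RatFunc F))).mp hp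

/-- The polynomial `X^(q^n) - X` is separable, hence squarefree, so no prime divides it twice. -/
theorem X_sub_X_pow_notMem_sq {n : ℕ} (hn : n ≠ 0) :
    (X - X ^ Fintype.card F ^ n : F[X]) ∉ v.asIdeal ^ 2 := by
  intro h
  obtain ⟨g, hg⟩ := (IsPrincipalIdealRing.principal v.asIdeal).principal
  have hg' : v.asIdeal = Ideal.span {g} := hg
  rw [hg', Ideal.span_singleton_pow, Ideal.mem_span_singleton] at h
  have hsep : (X ^ Fintype.card F ^ n - X : F[X]).Separable := by
    obtain ⟨p, hp⟩ := CharP.exists F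
    exact galois_poly_separable p _
      (dvd_pow ((CharP.cast_eq_zero_iff F p _).mp (FiniteField.cast_card_eq_zero F)) hn)
  have hdvd : g * g ∣ X ^ Fintype.card F ^ n - X := by
    rw [← sq, ← neg_sub, dvd_neg]
    exact h
  have hu := hsep.squarefree g hdvd
  exact v.isPrime.ne_top (by rw [hg', Ideal.span_singleton_eq_top.mpr hu])

theorem exists_le_norm_theta_sub :
    ∃ c : ℝ, 0 < c ∧ ∀ n ≠ 0, c ≤ ‖theta v - theta v ^ Fintype.card F ^ n‖ := by
  obtain ⟨π, hπ⟩ := v.valuation_exists_uniformizer (RatFunc F)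
  have hπ0 : π ≠ 0 := by
    rintro rfl
    rw [map_zero] at hπ
    exact WithZero.exp_ne_zero hπ.symm
  -- Not lying in the square of the prime bounds the valuation from below by that of `π ^ 2`,
  -- independently of `n`.
  refine ⟨‖algebraMap (RatFunc F) (Cv v) (π ^ 2)‖,
    norm_pos_iff.mpr ((_root_.map_ne_zero _).mpr (pow_ne_zero 2 hπ0)), fun n hn => ?_⟩
  have : theta v - theta v ^ Fintype.card F ^ n =
      algebraMap (RatFunc F) (Cv v) (algebraMap F[X] (RatFunc F) (X - X ^ Fintype.card F ^ n)) := by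
    rw [← aeval_theta]
    simp
  rw [this, norm_algebraMap_Cv_le_iff, HeightOneSpectrum.valuation_of_algebraMap, map_pow, hπ]
  have h := mt (v.intValuation_le_pow_iff_mem (X - X ^ Fintype.card F ^ n) 2).mp
    (X_sub_X_pow_notMem_sq v hn)
  rw [not_le] at h
  refine le_trans (le_of_eq ?_) h.le
  rw [← WithZero.exp_nsmul]
  rfl

end FunctionFieldPlace

/-! ### Ultrametric estimates and additivity of the Frobenius -/

theorem IsUltrametricDist.norm_sum_lt_of_forall_lt {K ι : Type*} [SeminormedAddCommGroup K]
    [IsUltrametricDist K] {t : Finset ι} {f : ι → K} {C : ℝ} (hC : 0 < C)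
    (h : ∀ i ∈ t, ‖f i‖ < C) : ‖∑ i ∈ t, f i‖ < C := by
  classical
  induction t using Finset.induction_on with
  | empty => simpa using hC
  | insert i t hi ih =>
    rw [Finset.sum_insert hi]
    exact (IsUltrametricDist.norm_add_le_max _ _).trans_lt
      (max_lt (h i (by simp)) (ih fun j hj => h j (by simp [hj])))

theorem tendsto_pow_mul_pow_pow_atTop {B x : ℝ} (hB : 0 ≤ B) (hx : 0 ≤ x) (hx1 : x < 1) {q : ℕ}
    (hq : 2 ≤ q) : Tendsto (fun k : ℕ => B ^ k * x ^ q ^ k) atTop (𝓝 0) := by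
  -- With `B < q^M`, the factor `B^k` is at most `(q^k)^M`, and `n^M x^n → 0` is applied along `n =
  -- q^k`.
  obtain ⟨M, hM⟩ := pow_unbounded_of_one_lt B (show (1 : ℝ) < q by exact_mod_cast hq)
  have h1 := (tendsto_pow_const_mul_const_pow_of_abs_lt_one M
    (by rwa [abs_of_nonneg hx])).comp (tendsto_pow_atTop_atTop_of_one_lt (by omega : 1 < q))
  refine squeeze_zero (fun k => by positivity) (fun k => ?_) h1
  dsimp only [Function.comp_apply]
  gcongr
  rw [Nat.cast_pow, ← pow_mul, mul_comm k M, pow_mul]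
  gcongr

theorem norm_algebraMap_le_one {F K : Type*} [Field F] [Fintype F] [NormedField K] [Algebra F K]
    (c : F) : ‖algebraMap F K c‖ ≤ 1 := by
  have h : ‖algebraMap F K c‖ ^ Fintype.card F = ‖algebraMap F K c‖ := by
    rw [← norm_pow, ← map_pow, FiniteField.pow_card]
  by_contra! h1
  have := lt_self_pow₀ h1 (Fintype.one_lt_card (α := F))
  exact this.ne h.symm

theorem algebraMap_pow_card_pow {F K : Type*} [Field F] [Fintype F] [Field K] [Algebra F K]
    (c : F) (k : ℕ) : algebraMap F K c ^ Fintype.card F ^ k = algebraMap F K c := by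
  rw [← FiniteField.frobeniusAlgHom_pow_apply, AlgHom.commutes]

theorem add_pow_card_pow (F : Type*) {K : Type*} [Field F] [Fintype F] [Field K] [Algebra F K]
    (x y : K) (k : ℕ) :
    (x + y) ^ Fintype.card F ^ k = x ^ Fintype.card F ^ k + y ^ Fintype.card F ^ k := by
  simp only [← FiniteField.frobeniusAlgHom_pow_apply F k, map_add]

theorem sum_pow_card_pow (F : Type*) {K ι : Type*} [Field F] [Fintype F] [Field K] [Algebra F K]
    (t : Finset ι) (x : ι → K) (k : ℕ) :
    (∑ i ∈ t, x i) ^ Fintype.card F ^ k = ∑ i ∈ t, x i ^ Fintype.card F ^ k := by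
  simp only [← FiniteField.frobeniusAlgHom_pow_apply F k, map_sum]

namespace CMSPL

/-- The properties of the element `θ` of `ℂ_v`, for `v` finite, that make the logarithms of
`t`-modules converge on the open unit polydisc. -/
structure IsIntegralTheta (F : Type*) [Field F] [Fintype F] {K : Type*} [NormedField K]
    [Algebra F K] (θ : K) : Prop where
  norm_le_one : ‖θ‖ ≤ 1
  exists_le : ∃ c : ℝ, 0 < c ∧ ∀ n ≠ 0, c ≤ ‖θ - θ ^ Fintype.card F ^ n‖
  transcendental : Transcendental F θ

/-! ### Points of `G` as a module over `𝔽_q[t]` -/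

section Action

variable {r : ℕ} (s : Fin r → ℕ) {F : Type*} [Field F] [Fintype F] {K : Type*} [NormedField K]
  [Algebra F K] (θ : K) (u : Fin r → K)

theorem IsIntegralTheta.pow_ne {θ : K} (hθ : IsIntegralTheta F θ) (n : ℕ) (hn : n ≠ 0) :
    θ ^ Fintype.card F ^ n ≠ θ := by
  obtain ⟨c, hc, h⟩ := hθ.exists_le
  intro h'
  have := h n hn
  rw [h', sub_self, norm_zero] at this
  exact this.not_gt hc

theorem IsIntegralTheta.aeval_ne_zero {θ : K} (hθ : IsIntegralTheta F θ) {a : F[X]} (ha : a ≠ 0) :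
    aeval θ a ≠ 0 := fun h => ha (transcendental_iff.mp hθ.transcendental a h)

variable (F) in
/-- The action of `t` on the points of `G_{s,u}`. -/
def tAction : Module.End F (Idx s → K) where
  toFun x := (Matrix.scalar (Idx s) θ + matN s).mulVec x +
    (matE s u).mulVec (fun c => x c ^ Fintype.card F)
  map_add' x y := by
    have : (fun c => (x + y) c ^ Fintype.card F) =
        (fun c => x c ^ Fintype.card F) + fun c => y c ^ Fintype.card F := by
      ext c
      have := add_pow_card_pow F (x c) (y c) 1
      rwa [pow_one] at this
    rw [this, Matrix.mulVec_add, Matrix.mulVec_add]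
    abel
  map_smul' c x := by
    have : (fun i => (c • x) i ^ Fintype.card F) = c • fun i => x i ^ Fintype.card F := by
      ext i
      simp only [Pi.smul_apply, Algebra.smul_def, mul_pow]
      rw [← map_pow, FiniteField.pow_card]
    rw [this, Matrix.mulVec_smul, Matrix.mulVec_smul, RingHom.id_apply, smul_add]

theorem tAction_apply (x : Idx s → K) :
    tAction s F θ u x = (Matrix.scalar (Idx s) θ + matN s).mulVec x +
      (matE s u).mulVec (fun c => x c ^ Fintype.card F) := rfl

theorem eval_eq_sum {g : TwistedSeries F K (Idx s)} {M : ℕ} (hg : ∀ n ≥ M, g n = 0)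
    (x : Idx s → K) :
    g.eval x = ∑ n ∈ Finset.range M, (g n).mulVec (fun c => x c ^ Fintype.card F ^ n) := by
  ext b
  rw [TwistedSeries.eval, tsum_eq_sum (s := Finset.range M), Finset.sum_apply]
  intro n hn
  rw [hg n (by simpa using hn), Matrix.zero_mulVec, Pi.zero_apply]

theorem twistMat_mulVec_pow (M : Matrix (Idx s) (Idx s) K) (n : ℕ) (x : Idx s → K) :
    (twistMat F K (Idx s) 1 M).mulVec (fun c => x c ^ Fintype.card F ^ (n + 1)) =
      fun b => (M.mulVec fun c => x c ^ Fintype.card F ^ n) b ^ Fintype.card F := by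
  ext b
  have := sum_pow_card_pow F Finset.univ (fun c => M b c * x c ^ Fintype.card F ^ n) 1
  rw [pow_one] at this
  simp only [Matrix.mulVec, dotProduct, twistMat_apply, Matrix.map_apply, this, mul_pow, pow_one]
  simp only [← pow_mul, pow_succ]

theorem eval_rhoT_mul {g : TwistedSeries F K (Idx s)} {M : ℕ} (hg : ∀ n ≥ M, g n = 0)
    (x : Idx s → K) :
    (∀ n ≥ M + 1, (rhoT s F θ u * g) n = 0) ∧
      (rhoT s F θ u * g).eval x = tAction s F θ u (g.eval x) := by
  have h0 : ∀ n ≥ M + 1, (rhoT s F θ u * g) n = 0 := by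
    intro n hn
    obtain ⟨n, rfl⟩ : ∃ k, n = k + 1 := ⟨n - 1, by omega⟩
    rw [rhoT_mul_apply_succ, hg _ (by omega), hg n (by omega), map_zero, mul_zero, mul_zero,
      add_zero]
  refine ⟨h0, ?_⟩
  rw [eval_eq_sum s h0, eval_eq_sum s hg, map_sum, Finset.sum_range_succ']
  simp only [rhoT_mul_apply_succ, Matrix.add_mulVec _ (matE s u * _), ← Matrix.mulVec_mulVec,
    twistMat_mulVec_pow, tAction_apply]
  rw [Finset.sum_add_distrib, Finset.sum_add_distrib, add_right_comm]
  congr 1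
  have h1 : (rhoT s F θ u * g) 0 = (Matrix.scalar (Idx s) θ + matN s) * g 0 :=
    TwistedSeries.mul_apply_zero _ _
  rw [h1, ← Matrix.mulVec_mulVec]
  refine (Finset.sum_range_succ' (fun n => (Matrix.scalar (Idx s) θ + matN s).mulVec
      ((g n).mulVec fun c => x c ^ Fintype.card F ^ n)) M).symm.trans ?_
  rw [Finset.sum_range_succ, hg M le_rfl, Matrix.zero_mulVec, Matrix.mulVec_zero, add_zero]

/-- Evaluation turns composition into iteration, so `ρ_a` acts on points as the polynomial `a` in
one endomorphism. The bound on the degree in `τ` is carried along because `eval` is a `tsum`, whose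
additivity would otherwise require summability. -/
theorem eval_rho (a : F[X]) (x : Idx s → K) :
    (∃ M, ∀ n ≥ M, rho s F θ u a n = 0) ∧
      (rho s F θ u a).eval x = aeval (tAction s F θ u) a x := by
  induction a using Polynomial.induction_on with
  | C c =>
    have h0 : ∀ n ≥ 1, rho s F θ u (C c) n = 0 := by
      intro n hn
      rw [← Polynomial.algebraMap_eq, AlgHom.commutes, TwistedSeries.algebraMap_eq_const,
        TwistedSeries.const_apply, if_neg (by omega)]
    refine ⟨⟨1, h0⟩, ?_⟩
    rw [eval_eq_sum s h0, ← Polynomial.algebraMap_eq, AlgHom.commutes, AlgHom.commutes,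
      TwistedSeries.algebraMap_eq_const, Finset.sum_range_one, TwistedSeries.const_apply,
      if_pos rfl, Algebra.algebraMap_eq_smul_one, Algebra.algebraMap_eq_smul_one,
      Matrix.smul_mulVec, Matrix.one_mulVec]
    simp
  | add a b ha hb =>
    obtain ⟨⟨M, hM⟩, ha⟩ := ha
    obtain ⟨⟨M', hM'⟩, hb⟩ := hb
    have h0 : ∀ n ≥ max M M', rho s F θ u (a + b) n = 0 := fun n hn => by
      rw [map_add, TwistedSeries.add_apply, hM n (le_of_max_le_left hn),
        hM' n (le_of_max_le_right hn), add_zero]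
    refine ⟨⟨_, h0⟩, ?_⟩
    rw [eval_eq_sum s h0, map_add (aeval (tAction s F θ u)), LinearMap.add_apply, ← ha, ← hb,
      eval_eq_sum s (M := max M M') fun n hn => hM n (le_of_max_le_left hn),
      eval_eq_sum s (M := max M M') fun n hn => hM' n (le_of_max_le_right hn),
      ← Finset.sum_add_distrib]
    simp only [map_add, TwistedSeries.add_apply, Matrix.add_mulVec]
  | monomial n c h =>
    obtain ⟨⟨M, hM⟩, h⟩ := h
    have h1 := eval_rhoT_mul s θ u hM x
    have h2 : (C c * X ^ (n + 1) : F[X]) = X * (C c * X ^ n) := by ring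
    rw [h2, map_mul (rho s F θ u) X, rho_X, map_mul (aeval (tAction s F θ u)) X, aeval_X,
      Module.End.mul_apply, ← h]
    exact ⟨⟨_, h1.1⟩, h1.2⟩

/-- A subspace stable under `t` is stable under all `ρ_a`. -/
theorem aeval_apply_mem {R M : Type*} [CommRing R] [AddCommGroup M] [Module R M]
    {φ : Module.End R M} {S : Submodule R M} (hφ : ∀ x ∈ S, φ x ∈ S) (a : R[X]) {x : M}
    (hx : x ∈ S) : aeval φ a x ∈ S := by
  induction a using Polynomial.induction_on with
  | C c => simpa [Polynomial.aeval_C, Algebra.algebraMap_eq_smul_one] using S.smul_mem c hx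
  | add a b ha hb =>
    rw [map_add]
    exact S.add_mem ha hb
  | monomial n c h =>
    have h2 : (C c * X ^ (n + 1) : R[X]) = X * (C c * X ^ n) := by ring
    rw [h2, map_mul, aeval_X]
    exact hφ _ h

variable {s θ u} in
theorem tAction_apply_mem (S : Subalgebra F K) (hθ : θ ∈ S) (hu : ∀ i, u i ∈ S)
    {x : Idx s → K} (hx : ∀ c, x c ∈ S) (c : Idx s) : tAction s F θ u x c ∈ S := by
  rw [tAction_apply, Pi.add_apply]
  refine add_mem (sum_mem fun z _ => mul_mem ?_ (hx z)) (sum_mem fun z _ => mul_mem ?_ ?_)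
  · beta_reduce
    rw [Matrix.add_apply]
    refine add_mem ?_ ?_
    · rw [Matrix.scalar_apply, Matrix.diagonal_apply]
      split_ifs
      exacts [hθ, zero_mem S]
    · rw [matN]
      split_ifs
      exacts [one_mem S, zero_mem S]
  · beta_reduce
    rw [matE]
    split_ifs
    exacts [mul_mem (pow_mem (neg_mem (one_mem S)) _) (prod_mem fun i _ => hu i), zero_mem S]
  · exact pow_mem (hx z) _

theorem specialPoint_mem {s : Fin r → ℕ} {u : Fin r → K} (S : Subalgebra F K)
    (hu : ∀ i, u i ∈ S) (c : Idx s) : specialPoint s u c ∈ S := by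
  rw [specialPoint]
  split_ifs
  exacts [mul_mem (pow_mem (neg_mem (one_mem S)) _) (prod_mem fun i _ => hu i), zero_mem S]

/-- Taking for `S` the elements algebraic over `k` gives the algebraicity of the coordinates
`V_{m,j}`. -/
theorem aeval_tAction_specialPoint_mem {s : Fin r → ℕ} {θ : K} {u : Fin r → K}
    (S : Subalgebra F K) (hθ : θ ∈ S) (hu : ∀ i, u i ∈ S) (a : F[X]) (c : Idx s) :
    aeval (tAction s F θ u) a (specialPoint s u) c ∈ S := by
  let T : Submodule F (Idx s → K) := Submodule.pi Set.univ fun _ => Subalgebra.toSubmodule S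
  have hT : ∀ x, x ∈ T ↔ ∀ c, x c ∈ S := fun x => by simp [T, Submodule.mem_pi]
  exact (hT _).mp (aeval_apply_mem (S := T)
    (fun x hx => (hT _).mpr (tAction_apply_mem S hθ hu ((hT x).mp hx))) a
    ((hT _).mpr (specialPoint_mem S hu))) c

variable [IsUltrametricDist K]

-- The two summands of the action of `t` are bounded separately because the logarithmic series is
-- split along them in `logSum_tAction`.
variable {s θ u} in
theorem norm_tAction_lt_one (hθ : ‖θ‖ ≤ 1) (hu : ∀ i, ‖u i‖ ≤ 1) {x : Idx s → K}
    (hx : ∀ c, ‖x c‖ < 1) :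
    (∀ c, ‖(Matrix.scalar (Idx s) θ + matN s).mulVec x c‖ < 1) ∧
    (∀ c, ‖(matE s u).mulVec (fun c => x c ^ Fintype.card F) c‖ < 1) := by
  constructor
  · refine fun c => IsUltrametricDist.norm_sum_lt_of_forall_lt one_pos fun z _ => ?_
    rw [norm_mul]
    refine mul_lt_one_of_nonneg_of_lt_one_right ?_ (norm_nonneg _) (hx z)
    beta_reduce
    rw [Matrix.add_apply]
    refine (IsUltrametricDist.norm_add_le_max _ _).trans (max_le ?_ ?_)
    · rw [Matrix.scalar_apply, Matrix.diagonal_apply]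
      split_ifs
      · exact hθ
      · simp
    · rw [matN]
      split_ifs <;> simp
  · refine fun c => IsUltrametricDist.norm_sum_lt_of_forall_lt one_pos fun z _ => ?_
    rw [norm_mul, norm_pow]
    refine mul_lt_one_of_nonneg_of_lt_one_right ?_ (by positivity)
      (pow_lt_one₀ (norm_nonneg _) (hx z) Fintype.card_ne_zero)
    beta_reduce
    rw [matE]
    split_ifs
    · rw [norm_mul, norm_pow, norm_neg, norm_one, one_pow, one_mul, norm_prod]
      exact Finset.prod_le_one (fun _ _ => norm_nonneg _) fun i _ => hu i
    · simp

/-- The open unit polydisc. -/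
def polydisc (F : Type*) [Field F] [Fintype F] (K : Type*) [NormedField K] [Algebra F K]
    [IsUltrametricDist K] (ι : Type*) : Submodule F (ι → K) where
  carrier := {x | ∀ c, ‖x c‖ < 1}
  add_mem' hx hy c := (IsUltrametricDist.norm_add_le_max _ _).trans_lt (max_lt (hx c) (hy c))
  zero_mem' c := by simp
  smul_mem' a x hx c := by
    rw [Pi.smul_apply, Algebra.smul_def, norm_mul]
    exact mul_lt_one_of_nonneg_of_lt_one_right (norm_algebraMap_le_one a) (norm_nonneg _) (hx c)

variable {s θ u} in
theorem tAction_mem_polydisc (hθ : ‖θ‖ ≤ 1) (hu : ∀ i, ‖u i‖ ≤ 1) (x : Idx s → K)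
    (hx : x ∈ polydisc F K (Idx s)) : tAction s F θ u x ∈ polydisc F K (Idx s) := by
  obtain ⟨h1, h2⟩ := norm_tAction_lt_one (F := F) hθ hu hx
  exact (polydisc F K (Idx s)).add_mem h1 h2

end Action

/-! ### Convergence and functional equation of the logarithm -/

section Convergence

variable {F : Type*} [Field F] [Fintype F] {K : Type*} [NormedField K] [IsUltrametricDist K]
  [Algebra F K] {θ : K}

theorem IsIntegralTheta.norm_sub_pow_le (hθ : IsIntegralTheta F θ) (k : ℕ) :
    ‖θ - θ ^ Fintype.card F ^ k‖ ≤ 1 := by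
  rw [sub_eq_add_neg]
  refine (IsUltrametricDist.norm_add_le_max _ _).trans (max_le hθ.norm_le_one ?_)
  rw [norm_neg, norm_pow]
  exact pow_le_one₀ (norm_nonneg _) hθ.norm_le_one

theorem IsIntegralTheta.exists_norm_inv_bigL_le (hθ : IsIntegralTheta F θ) :
    ∃ b : ℝ, 1 ≤ b ∧ ∀ k, ‖(bigL F θ k)⁻¹‖ ≤ b ^ k := by
  obtain ⟨c, hc, h⟩ := hθ.exists_le
  have h1 : c ≤ 1 := (h 1 one_ne_zero).trans (hθ.norm_sub_pow_le 1)
  refine ⟨c⁻¹, (one_le_inv₀ hc).mpr h1, fun k => ?_⟩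
  induction k with
  | zero => simp [bigL_zero]
  | succ k ih =>
    rw [bigL_succ, mul_inv, norm_mul, pow_succ, norm_inv (θ - _)]
    exact mul_le_mul ih (inv_anti₀ hc (h _ k.succ_ne_zero)) (by positivity)
      (pow_nonneg (inv_nonneg.mpr hc.le) k)

theorem norm_liFactor_le {b : ℝ} (hL : ∀ k, ‖(bigL F θ k)⁻¹‖ ≤ b ^ k) {w : ℕ → K} {σ : ℕ → ℕ}
    {e : ℕ} (hw : ‖w e‖ ≤ 1) (k : ℕ) : ‖liFactor F θ w σ e k‖ ≤ (b ^ k) ^ σ e := by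
  rw [liFactor, div_eq_mul_inv, ← inv_pow, norm_mul, norm_pow, norm_pow]
  calc ‖w e‖ ^ Fintype.card F ^ k * ‖(bigL F θ k)⁻¹‖ ^ σ e ≤ 1 * (b ^ k) ^ σ e := by
        gcongr
        · exact pow_le_one₀ (norm_nonneg _) hw
        · exact hL k
    _ = _ := one_mul _

/-- The assumption `1 ≤ b` allows every inner index `j ≤ k` to be replaced by `k` in the bound. -/
theorem norm_nestedSum_le {b : ℝ} (hb : 1 ≤ b) (hL : ∀ k, ‖(bigL F θ k)⁻¹‖ ≤ b ^ k) {w : ℕ → K}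
    {σ : ℕ → ℕ} {m : ℕ} (hw : ∀ e < m, ‖w e‖ ≤ 1) (k : ℕ) :
    ‖nestedSum (liFactor F θ w σ) k m‖ ≤ (b ^ k) ^ ∑ e ∈ Finset.range m, σ e := by
  have hb0 : 0 ≤ b := by linarith
  induction m generalizing k with
  | zero => simp [nestedSum_zero]
  | succ m ih =>
    rw [nestedSum_succ]
    refine IsUltrametricDist.norm_sum_le_of_forall_le_of_nonneg (by positivity) fun j hj => ?_
    rw [norm_mul, Finset.sum_range_succ, pow_add, mul_comm]
    have hjk : b ^ j ≤ b ^ k := pow_le_pow_right₀ hb (by have := Finset.mem_range.mp hj; omega)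
    have h1 := ih (fun e he => hw e (by omega)) j
    have h2 := norm_liFactor_le (σ := σ) hL (hw m (by omega)) j
    refine mul_le_mul (h1.trans ?_) (h2.trans ?_) (norm_nonneg _) (by positivity) <;> gcongr

theorem norm_strictNestedSum_le {b : ℝ} (hb : 1 ≤ b) (hL : ∀ k, ‖(bigL F θ k)⁻¹‖ ≤ b ^ k)
    {w : ℕ → K} {σ : ℕ → ℕ} {m : ℕ} (hw : ∀ e < m, ‖w e‖ ≤ 1) (k : ℕ) :
    ‖strictNestedSum (liFactor F θ w σ) k m‖ ≤ (b ^ k) ^ ∑ e ∈ Finset.range m, σ e := by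
  have hb0 : 0 ≤ b := by linarith
  cases k with
  | zero =>
    rw [strictNestedSum]
    split_ifs <;> simp
  | succ k =>
    refine (norm_nestedSum_le hb hL hw k).trans ?_
    gcongr
    exact k.le_succ

variable {r : ℕ} {s : Fin r → ℕ} {u : Fin r → K}

theorem norm_entry_le (hu : ∀ i, ‖u i‖ ≤ 1) (e : ℕ) : ‖entry u e‖ ≤ 1 := by
  rw [entry]
  split_ifs
  · exact hu _
  · simp

theorem exists_norm_logRow_le (hθ : IsIntegralTheta F θ) (hu : ∀ i, ‖u i‖ ≤ 1)
    (hd : ∀ l, 0 < blockDim s l) {x₀ : Idx s}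
    (hx₀ : (x₀.2 : ℕ) + 1 = blockDim s x₀.1) (hx₀' : (x₀.1 : ℕ) = 0) :
    ∃ B : ℝ, 0 ≤ B ∧ ∀ k x, ‖logRow F θ s u x₀ k x‖ ≤ B ^ k := by
  obtain ⟨b, hb, hL⟩ := hθ.exists_norm_inv_bigL_le
  have hb0 : 0 ≤ b := by linarith
  -- The power `L_k^(d_m)` accounts for the exponents from block `m` on, the nested sum for those
  -- before it; together they give the full weight.
  refine ⟨b ^ ∑ e ∈ Finset.range r, entry s (e + 1), by positivity, fun k ⟨m, j⟩ => ?_⟩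
  rw [logRow_eq u hθ.pow_ne hd hx₀ hx₀', div_eq_mul_inv, ← inv_pow, norm_mul, norm_mul, norm_mul,
    norm_pow, norm_neg, norm_one, one_pow, one_mul, norm_pow, norm_pow]
  have h1 : ‖θ - θ ^ Fintype.card F ^ k‖ ≤ 1 := hθ.norm_sub_pow_le k
  have h2 := norm_strictNestedSum_le (m := m) hb hL (w := fun e => entry u (e + 1))
    (σ := fun e => entry s (e + 1)) (fun e _ => norm_entry_le hu _) k
  calc _ ≤ 1 * (b ^ k) ^ blockDim s m *
        (b ^ k) ^ ∑ e ∈ Finset.range m, entry s (e + 1) := by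
        gcongr
        · exact pow_le_one₀ (norm_nonneg _) h1
        · exact hL k
    _ = _ := by
        rw [one_mul, ← pow_add, ← pow_mul, ← pow_mul, blockDim_eq_sum_entry, add_comm,
          Finset.sum_range_add_sum_Ico _ m.2.le, mul_comm]

variable [CompleteSpace K]

/-- Over a complete ultrametric field it suffices that the terms tend to zero. -/
theorem summable_of_norm_le_pow {B : ℝ} (hB : 0 ≤ B) {p : ℕ → K} (hp : ∀ k, ‖p k‖ ≤ B ^ k) {x : K}
    (hx : ‖x‖ < 1) : Summable fun k => p k * x ^ Fintype.card F ^ k := by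
  refine NonarchimedeanAddGroup.summable_of_tendsto_cofinite_zero ?_
  rw [Nat.cofinite_eq_atTop]
  refine squeeze_zero_norm (fun k => ?_)
    (tendsto_pow_mul_pow_pow_atTop hB (norm_nonneg x) hx (Fintype.one_lt_card (α := F)))
  rw [norm_mul, norm_pow]
  gcongr
  exact hp k

variable (F θ s u) in
/-- The coordinate of index `x₀` of `log_G`. -/
def logSum (x₀ : Idx s) (x : Idx s → K) : K :=
  ∑' k, ∑ c, logRow F θ s u x₀ k c * x c ^ Fintype.card F ^ k

theorem summable_logRow_mul (hθ : IsIntegralTheta F θ) (hu : ∀ i, ‖u i‖ ≤ 1)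
    (hd : ∀ l, 0 < blockDim s l) {x₀ : Idx s}
    (hx₀ : (x₀.2 : ℕ) + 1 = blockDim s x₀.1) (hx₀' : (x₀.1 : ℕ) = 0) {x : Idx s → K}
    (hx : ∀ c, ‖x c‖ < 1) (c : Idx s) :
    Summable fun k => logRow F θ s u x₀ k c * x c ^ Fintype.card F ^ k := by
  obtain ⟨B, hB, h⟩ := exists_norm_logRow_le hθ hu hd hx₀ hx₀'
  exact summable_of_norm_le_pow hB (fun k => h k c) (hx c)

theorem summable_sum_logRow_mul (hθ : IsIntegralTheta F θ) (hu : ∀ i, ‖u i‖ ≤ 1)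
    (hd : ∀ l, 0 < blockDim s l) {x₀ : Idx s}
    (hx₀ : (x₀.2 : ℕ) + 1 = blockDim s x₀.1) (hx₀' : (x₀.1 : ℕ) = 0) {x : Idx s → K}
    (hx : ∀ c, ‖x c‖ < 1) :
    Summable fun k => ∑ c, logRow F θ s u x₀ k c * x c ^ Fintype.card F ^ k :=
  summable_sum fun c _ => summable_logRow_mul hθ hu hd hx₀ hx₀' hx c

/-- The functional equation of the logarithm. -/
theorem logSum_tAction (hθ : IsIntegralTheta F θ) (hu : ∀ i, ‖u i‖ ≤ 1)
    (hd : ∀ l, 0 < blockDim s l) {x₀ : Idx s}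
    (hx₀ : (x₀.2 : ℕ) + 1 = blockDim s x₀.1) (hx₀' : (x₀.1 : ℕ) = 0) {x : Idx s → K}
    (hx : ∀ c, ‖x c‖ < 1) :
    logSum F θ s u x₀ (tAction s F θ u x) = θ * logSum F θ s u x₀ x := by
  obtain ⟨h1, h2⟩ := norm_tAction_lt_one (F := F) hθ.norm_le_one hu hx
  have hA := summable_sum_logRow_mul (u := u) hθ hu hd hx₀ hx₀' h1
  have hB := summable_sum_logRow_mul (u := u) hθ hu hd hx₀ hx₀' h2
  have hC := summable_sum_logRow_mul (u := u) hθ hu hd hx₀ hx₀' hx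
  -- The entries of `N` are `0` or `1`, so the Frobenius fixes them and only `θ` is twisted.
  have hA' : ∀ k, ∑ c, logRow F θ s u x₀ k c *
      (Matrix.scalar (Idx s) θ + matN s).mulVec x c ^ Fintype.card F ^ k =
      ∑ c, (logRow F θ s u x₀ k c * θ ^ Fintype.card F ^ k +
        ∑ z, logRow F θ s u x₀ k z * matN s z c) * x c ^ Fintype.card F ^ k := by
    intro k
    simp only [Matrix.add_mulVec, Pi.add_apply, add_pow_card_pow F, mul_add, add_mul,
      Finset.sum_add_distrib]
    congr 1
    · refine Finset.sum_congr rfl fun c _ => ?_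
      rw [mul_assoc, ← mul_pow, Matrix.scalar_apply, Matrix.mulVec_diagonal]
    · simp only [Matrix.mulVec, dotProduct, sum_pow_card_pow F, Finset.mul_sum, Finset.sum_mul]
      rw [Finset.sum_comm]
      refine Finset.sum_congr rfl fun c _ => Finset.sum_congr rfl fun z _ => ?_
      rw [mul_pow, ← mul_assoc]
      congr 2
      rw [matN]
      split_ifs
      · rw [one_pow]
      · rw [zero_pow (by positivity)]
  have hB' : ∀ k, ∑ c, logRow F θ s u x₀ k c *
      (matE s u).mulVec (fun c => x c ^ Fintype.card F) c ^ Fintype.card F ^ k =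
      ∑ c, (∑ z, logRow F θ s u x₀ k z * matE s u z c ^ Fintype.card F ^ k) *
        x c ^ Fintype.card F ^ (k + 1) := by
    intro k
    simp only [Matrix.mulVec, dotProduct, sum_pow_card_pow F, Finset.mul_sum, Finset.sum_mul]
    rw [Finset.sum_comm]
    refine Finset.sum_congr rfl fun c _ => Finset.sum_congr rfl fun z _ => ?_
    rw [mul_pow, ← mul_assoc, ← pow_mul, pow_succ']
  have h0 : ∑ c, logRow F θ s u x₀ 0 c *
      (Matrix.scalar (Idx s) θ + matN s).mulVec x c ^ Fintype.card F ^ 0 =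
      θ * ∑ c, logRow F θ s u x₀ 0 c * x c ^ Fintype.card F ^ 0 := by
    rw [hA', Finset.mul_sum]
    refine Finset.sum_congr rfl fun c _ => ?_
    simp [logRow_zero u hθ.pow_ne, matN_apply_of_last hx₀, mul_comm]
  have hsucc : ∀ k, (∑ c, logRow F θ s u x₀ (k + 1) c *
      (Matrix.scalar (Idx s) θ + matN s).mulVec x c ^ Fintype.card F ^ (k + 1)) +
      ∑ c, logRow F θ s u x₀ k c *
        (matE s u).mulVec (fun c => x c ^ Fintype.card F) c ^ Fintype.card F ^ k =
      θ * ∑ c, logRow F θ s u x₀ (k + 1) c * x c ^ Fintype.card F ^ (k + 1) := by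
    intro k
    rw [hA', hB', ← Finset.sum_add_distrib, Finset.mul_sum]
    refine Finset.sum_congr rfl fun c _ => ?_
    rw [← add_mul, logRow_succ u hθ.pow_ne hx₀, mul_assoc]
  have hsum : logSum F θ s u x₀ (tAction s F θ u x) =
      (∑' k, ∑ c, logRow F θ s u x₀ k c *
        (Matrix.scalar (Idx s) θ + matN s).mulVec x c ^ Fintype.card F ^ k) +
      ∑' k, ∑ c, logRow F θ s u x₀ k c *
        (matE s u).mulVec (fun c => x c ^ Fintype.card F) c ^ Fintype.card F ^ k := by
    rw [logSum, ← hA.tsum_add hB]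
    simp only [tAction_apply, Pi.add_apply, add_pow_card_pow F, mul_add, Finset.sum_add_distrib]
  -- The `E` part raises coordinates to one more `q`-th power, so its term of index `k` pairs with
  -- the term `k + 1` of the `θ + N` part; their sum is given by the recursion.
  rw [hsum, hA.tsum_eq_zero_add, add_assoc, ← ((summable_nat_add_iff 1).mpr hA).tsum_add hB]
  simp only [hsucc]
  rw [h0, logSum, tsum_mul_left, ← mul_add, hC.tsum_eq_zero_add]

theorem logSum_aeval_tAction (hθ : IsIntegralTheta F θ) (hu : ∀ i, ‖u i‖ ≤ 1)
    (hd : ∀ l, 0 < blockDim s l) {x₀ : Idx s}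
    (hx₀ : (x₀.2 : ℕ) + 1 = blockDim s x₀.1) (hx₀' : (x₀.1 : ℕ) = 0) (a : F[X]) {x : Idx s → K}
    (hx : ∀ c, ‖x c‖ < 1) :
    logSum F θ s u x₀ (aeval (tAction s F θ u) a x) = aeval θ a * logSum F θ s u x₀ x := by
  have hmem : ∀ a : F[X], ∀ c, ‖aeval (tAction s F θ u) a x c‖ < 1 := fun a =>
    aeval_apply_mem (S := polydisc F K (Idx s)) (tAction_mem_polydisc hθ.norm_le_one hu) a hx
  induction a using Polynomial.induction_on with
  | C c =>
    rw [aeval_C, aeval_C, logSum, logSum, ← tsum_mul_left]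
    refine tsum_congr fun k => ?_
    rw [Finset.mul_sum]
    refine Finset.sum_congr rfl fun i _ => ?_
    rw [Module.algebraMap_end_apply, Pi.smul_apply, Algebra.smul_def, mul_pow,
      algebraMap_pow_card_pow]
    ring
  | add a b ha hb =>
    rw [map_add, map_add, add_mul, ← ha, ← hb, logSum, logSum, logSum,
      ← (summable_sum_logRow_mul hθ hu hd hx₀ hx₀' (hmem a)).tsum_add
        (summable_sum_logRow_mul hθ hu hd hx₀ hx₀' (hmem b))]
    simp only [LinearMap.add_apply, Pi.add_apply, add_pow_card_pow F, mul_add,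
      Finset.sum_add_distrib]
  | monomial n c h =>
    have h2 : (C c * X ^ (n + 1) : F[X]) = X * (C c * X ^ n) := by ring
    rw [h2, map_mul, aeval_X, Module.End.mul_apply, logSum_tAction hθ hu hd hx₀ hx₀' (hmem _), h,
      map_mul (aeval θ) X, aeval_X, mul_assoc]

end Convergence

end CMSPL

namespace CMSPL

/-! ### Sums over weakly decreasing tuples as nested sums -/

section AntitoneTuples

/-- The weakly decreasing tuples with entries at most `k`. -/
def antitoneTuples (m k : ℕ) : Finset (Fin m → ℕ) :=
  open Classical in (Fintype.piFinset fun _ => Finset.range (k + 1)).filter Antitone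

theorem mem_antitoneTuples {m k : ℕ} {i : Fin m → ℕ} :
    i ∈ antitoneTuples m k ↔ (∀ n, i n ≤ k) ∧ Antitone i := by
  simp [antitoneTuples]

theorem antitone_cons_iff {m k : ℕ} {i : Fin m → ℕ} :
    Antitone (Fin.cons k i : Fin (m + 1) → ℕ) ↔ i ∈ antitoneTuples m k := by
  rw [mem_antitoneTuples]
  constructor
  · intro h
    refine ⟨fun n => h (Fin.zero_le n.succ), fun a b hab => ?_⟩
    exact h (Fin.succ_le_succ_iff.mpr hab)
  · rintro ⟨h1, h2⟩ a b hab
    induction a using Fin.cases with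
    | zero =>
      induction b using Fin.cases with
      | zero => exact le_rfl
      | succ b => exact h1 b
    | succ a =>
      induction b using Fin.cases with
      | zero => exact absurd (Fin.le_zero_iff.mp hab) (Fin.succ_ne_zero a)
      | succ b => exact h2 (Fin.succ_le_succ_iff.mp hab)

/-- Splitting off the first entry of a weakly decreasing tuple. -/
def antitoneConsEquiv (m : ℕ) :
    (Σ k : ℕ, antitoneTuples m k) ≃ {i : Fin (m + 1) → ℕ // Antitone i} where
  toFun x := ⟨Fin.cons x.1 x.2.1, antitone_cons_iff.mpr x.2.2⟩
  invFun i := ⟨i.1 0, ⟨Fin.tail i.1, antitone_cons_iff.mp (by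
    rw [Fin.cons_self_tail]
    exact i.2)⟩⟩
  left_inv _ := rfl
  right_inv i := Subtype.ext (Fin.cons_self_tail i.1)

theorem sum_antitoneTuples_succ {M : Type*} [AddCommMonoid M] (m k : ℕ) (f : (Fin (m + 1) → ℕ) → M) :
    ∑ i ∈ antitoneTuples (m + 1) k, f i =
      ∑ j ∈ Finset.range (k + 1), ∑ i ∈ antitoneTuples m j, f (Fin.cons j i) := by
  rw [Finset.sum_sigma']
  refine Finset.sum_nbij' (fun i => ⟨i 0, Fin.tail i⟩) (fun x => Fin.cons x.1 x.2) ?_ ?_ ?_ ?_ ?_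
  · intro i hi
    obtain ⟨h1, h2⟩ := mem_antitoneTuples.mp hi
    refine Finset.mem_sigma.mpr ⟨Finset.mem_range.mpr (Nat.lt_succ_of_le (h1 0)), ?_⟩
    refine antitone_cons_iff.mp ?_
    rwa [Fin.cons_self_tail]
  · rintro ⟨j, i⟩ h
    obtain ⟨h1, h2⟩ := Finset.mem_sigma.mp h
    have h3 := Nat.lt_succ_iff.mp (Finset.mem_range.mp h1)
    refine mem_antitoneTuples.mpr ⟨fun n => ?_, antitone_cons_iff.mpr h2⟩
    induction n using Fin.cases with
    | zero => exact h3
    | succ n => exact ((mem_antitoneTuples.mp h2).1 n).trans h3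
  · exact fun i _ => Fin.cons_self_tail i
  · exact fun _ _ => rfl
  · intro i _
    dsimp only
    rw [Fin.cons_self_tail]

/-- Both sides are peeled from the largest index. It is the first in a tuple but belongs to the last
factor `g (m - 1)`, hence the reversal. -/
theorem sum_antitoneTuples_prod {K : Type*} [CommRing K] (g : ℕ → ℕ → K) (m k : ℕ)
    (h : Fin m → ℕ → K) (hh : ∀ n : Fin m, h n = g (n.rev : ℕ)) :
    ∑ i ∈ antitoneTuples m k, ∏ n, h n (i n) = nestedSum g k m := by
  induction m generalizing k with
  | zero =>
    rw [nestedSum_zero, Finset.sum_eq_card_nsmul (b := 1) (by simp)]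
    have : antitoneTuples 0 k = {Fin.elim0} := by
      ext i
      simp only [mem_antitoneTuples, IsEmpty.forall_iff, true_and, Finset.mem_singleton]
      exact iff_of_true (fun a => a.elim0) (Subsingleton.elim _ _)
    simp [this]
  | succ m ih =>
    rw [sum_antitoneTuples_succ, nestedSum_succ]
    refine Finset.sum_congr rfl fun j _ => ?_
    rw [← ih j (fun n => h n.succ), Finset.mul_sum]
    · refine Finset.sum_congr rfl fun i _ => ?_
      rw [Fin.prod_univ_succ, hh 0]
      simp
    · intro n
      rw [hh]
      simp [Fin.rev_succ]

end AntitoneTuples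

/-! ### `Li⋆`: independence of `a` and the power series -/

section Li

variable {F : Type*} [Field F] [Fintype F] {K : Type*} [NormedField K] [IsUltrametricDist K]
  [CompleteSpace K] [Algebra F K] {θ : K} {r : ℕ} {s : Fin r → ℕ} {u : Fin r → K}

/-- The index of the last coordinate of the first block. -/
def lastIdx (s : Fin r → ℕ) (hr : 0 < r) (hd : ∀ l, 0 < blockDim s l) : Idx s :=
  ⟨⟨0, hr⟩, ⟨blockDim s ⟨0, hr⟩ - 1, Nat.sub_lt (hd _) Nat.one_pos⟩⟩

theorem lastIdx_snd_add_one (hr : 0 < r) (hd : ∀ l, 0 < blockDim s l) :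
    ((lastIdx s hr hd).2 : ℕ) + 1 = blockDim s (lastIdx s hr hd).1 := by
  have := hd ⟨0, hr⟩
  dsimp only [lastIdx]
  omega

theorem lastOfFirstBlock_eval_log (hr : 0 < r) (hd : ∀ l, 0 < blockDim s l) (x : Idx s → K) :
    lastOfFirstBlock s ((TwistedSeries.log (rho s F θ u)).eval x) =
      logSum F θ s u (lastIdx s hr hd) x := by
  rw [lastOfFirstBlock, dif_pos ⟨hr, hd _⟩]
  rfl

theorem rhoPoint_eq (a : F[X]) :
    rhoPoint F θ s u a = aeval (tAction (s ∘ Fin.rev) F θ (u ∘ Fin.rev)) a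
      (specialPoint (s ∘ Fin.rev) (u ∘ Fin.rev)) :=
  (eval_rho _ _ _ a _).2

/-- The value of the continued polylogarithm may be computed with any admissible `a`. -/
theorem Li_eq_of_isAdmissible (hθ : IsIntegralTheta F θ) (hr : 0 < r)
    (hd : ∀ l, 0 < blockDim (s ∘ Fin.rev) l) (hu : ∀ i, ‖u i‖ ≤ 1) {a : F[X]}
    (ha : IsAdmissible F θ s u a) :
    Li F θ s u = (-1) ^ (r - 1) / aeval θ a *
      logSum F θ (s ∘ Fin.rev) (u ∘ Fin.rev) (lastIdx (s ∘ Fin.rev) hr hd)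
        (rhoPoint F θ s u a) := by
  have h : ∃ a : F[X], IsAdmissible F θ s u a := ⟨a, ha⟩
  rw [Li, dif_pos h, lastOfFirstBlock_eval_log hr hd]
  have hb := h.choose_spec
  set b := h.choose
  have hu' : ∀ i, ‖(u ∘ Fin.rev) i‖ ≤ 1 := fun i => hu _
  have h1 := logSum_aeval_tAction hθ hu' hd (lastIdx_snd_add_one hr hd) rfl a hb.2
  have h2 := logSum_aeval_tAction hθ hu' hd (lastIdx_snd_add_one hr hd) rfl b ha.2
  -- Both sides are `ρ_{ab}` applied to the special point.
  have h3 : aeval (tAction (s ∘ Fin.rev) F θ (u ∘ Fin.rev)) a (rhoPoint F θ s u b) =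
      aeval (tAction (s ∘ Fin.rev) F θ (u ∘ Fin.rev)) b (rhoPoint F θ s u a) := by
    rw [rhoPoint_eq, rhoPoint_eq, ← Module.End.mul_apply, ← map_mul, ← Module.End.mul_apply,
      ← map_mul, mul_comm]
  rw [h3, h2] at h1
  have ha0 := hθ.aeval_ne_zero ha.1
  have hb0 := hθ.aeval_ne_zero hb.1
  field_simp
  rw [mul_comm]
  exact h1.symm

/-- Stated with an equation on `r` since the depth it is used for, `r + 1 - i` with `i = r + 1`, is
not syntactically `0`. -/
theorem Li_of_eq_zero (hr : r = 0) : Li F θ s u = 0 := by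
  subst hr
  rw [Li]
  split_ifs
  · rw [lastOfFirstBlock, dif_neg, mul_zero]
    rintro ⟨h, -⟩
    exact h.false
  · rfl

variable (F θ s u) in
/-- The factors of the terms of the polylogarithm, with reversed indices. -/
abbrev revFactor : ℕ → ℕ → K :=
  liFactor F θ (fun e => entry (u ∘ Fin.rev) (e + 1)) fun e => entry (s ∘ Fin.rev) (e + 1)

/-- Only the last coordinate of each block contributes, and the signs `(-1)^m` and `(-1)^(r-1-m)`
combine to one independent of the block. -/
theorem sum_logRow_mul_specialPoint (hθ : IsIntegralTheta F θ) (hr : 0 < r)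
    (hd : ∀ l, 0 < blockDim (s ∘ Fin.rev) l) (k : ℕ) :
    ∑ c, logRow F θ (s ∘ Fin.rev) (u ∘ Fin.rev) (lastIdx (s ∘ Fin.rev) hr hd) k c *
        specialPoint (s ∘ Fin.rev) (u ∘ Fin.rev) c ^ Fintype.card F ^ k =
      (-1) ^ (r - 1) * (u ⟨0, hr⟩ ^ Fintype.card F ^ k / bigL F θ k ^ s ⟨0, hr⟩ *
        nestedSum (revFactor F θ s u) k (r - 1)) := by
  set g := revFactor F θ s u with hg
  have hblock : ∀ m : Fin r, ∑ j : Fin (blockDim (s ∘ Fin.rev) m),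
      logRow F θ (s ∘ Fin.rev) (u ∘ Fin.rev) (lastIdx (s ∘ Fin.rev) hr hd) k ⟨m, j⟩ *
        specialPoint (s ∘ Fin.rev) (u ∘ Fin.rev) ⟨m, j⟩ ^ Fintype.card F ^ k =
      (fun l : ℕ => (-1) ^ (r - 1) *
        (strictNestedSum g k l * ∏ e ∈ Finset.Ico l r, g e k)) m := by
    intro m
    have hdm := hd m
    rw [Finset.sum_eq_single ⟨blockDim (s ∘ Fin.rev) m - 1, by omega⟩]
    · have hrev : ((⟨blockDim (s ∘ Fin.rev) m - 1, by omega⟩ :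
          Fin (blockDim (s ∘ Fin.rev) m)).rev : ℕ) = 0 := by
        rw [Fin.val_rev]
        dsimp only
        omega
      have hprod : ∏ e ∈ Finset.Ico (m : ℕ) r, g e k =
          (∏ e ∈ Finset.Ico (m : ℕ) r, entry (u ∘ Fin.rev) (e + 1) ^ Fintype.card F ^ k) /
            bigL F θ k ^ blockDim (s ∘ Fin.rev) m := by
        rw [blockDim_eq_sum_entry, hg]
        simp only [revFactor, liFactor]
        rw [Finset.prod_div_distrib, Finset.prod_pow_eq_pow_sum]
      have hsign : (-1 : K) ^ (r - 1) = (-1) ^ (m : ℕ) * (-1) ^ (r - 1 - (m : ℕ)) := by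
        rw [← pow_add, Nat.add_sub_cancel' (by have := m.2; omega)]
      rw [logRow_eq _ hθ.pow_ne hd (lastIdx_snd_add_one hr hd) rfl, hrev, pow_zero, mul_one,
        specialPoint, if_pos (by dsimp only; omega), mul_pow, FiniteField.neg_one_pow_pow_card,
        prod_Ici_eq_prod_entry, ← Finset.prod_pow, hsign]
      dsimp only
      rw [hprod]
      ring
    · intro j _ hj
      rw [specialPoint, if_neg, zero_pow (by positivity), mul_zero]
      intro h
      apply hj
      ext
      dsimp only at h ⊢
      omega
    · simp
  rw [Fintype.sum_sigma, Finset.sum_congr rfl fun m _ => hblock m, Fin.sum_univ_eq_sum_range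
    (fun l : ℕ => (-1) ^ (r - 1) * (strictNestedSum g k l * ∏ e ∈ Finset.Ico l r, g e k)) r,
    ← Finset.mul_sum]
  congr 1
  obtain ⟨n, rfl⟩ : ∃ n, r = n + 1 := ⟨r - 1, by omega⟩
  -- The blocks give the terms `l < r` of this decomposition. The missing term `l = r` is the strict
  -- sum, so what remains is the diagonal, where the largest index equals `k`.
  have h1 := nestedSum_eq_sum g k (n + 1)
  rw [nestedSum_succ_eq_add, Finset.sum_range_succ, Finset.Ico_self, Finset.prod_empty, mul_one,
    add_comm] at h1
  rw [← add_right_cancel h1, Nat.add_sub_cancel, hg]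
  congr 1
  simp only [revFactor, liFactor]
  have hu' := entry_val_add_one (u ∘ Fin.rev) (Fin.last n)
  have hs' := entry_val_add_one (s ∘ Fin.rev) (Fin.last n)
  rw [Fin.val_last, Function.comp_apply, Fin.rev_last] at hu' hs'
  rw [hu', hs']
  rfl

/-- Every nonzero coordinate of the special point contains the last entry of the reversed tuple,
which is `u_1`, the only variable required to be small. -/
theorem isAdmissible_one (hr : 0 < r) (hu : ∀ i, ‖u i‖ ≤ 1) (hu0 : ‖u ⟨0, hr⟩‖ < 1) :
    IsAdmissible F θ s u 1 := by
  refine ⟨one_ne_zero, fun c => ?_⟩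
  rw [rhoPoint_eq, map_one, Module.End.one_apply, specialPoint]
  split_ifs
  · rw [norm_mul, norm_pow, norm_neg, norm_one, one_pow, one_mul, norm_prod]
    have hlast : (⟨r - 1, by omega⟩ : Fin r) ∈ Finset.Ici c.1 := by
      rw [Finset.mem_Ici, Fin.le_def]
      have := c.1.2
      dsimp only
      omega
    rw [← Finset.mul_prod_erase _ _ hlast]
    refine mul_lt_one_of_nonneg_of_lt_one_left (norm_nonneg _) ?_
      (Finset.prod_le_one (fun _ _ => norm_nonneg _) fun i _ => hu _)
    have hrev : (⟨r - 1, by omega⟩ : Fin r).rev = ⟨0, hr⟩ := by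
      ext
      rw [Fin.val_rev]
      dsimp only
      omega
    rwa [Function.comp_apply, hrev]
  · simp

/-- In the convergent region, `Li⋆` is given by a convergent series over the first index. -/
theorem hasSum_nestedSum_Li (hθ : IsIntegralTheta F θ) (hr : 0 < r) (hs : ∀ i, 0 < s i)
    (hu : ∀ i, ‖u i‖ ≤ 1) (hu0 : ‖u ⟨0, hr⟩‖ < 1) :
    HasSum (fun k => u ⟨0, hr⟩ ^ Fintype.card F ^ k / bigL F θ k ^ s ⟨0, hr⟩ *
      nestedSum (revFactor F θ s u) k (r - 1)) (Li F θ s u) := by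
  have hd : ∀ l, 0 < blockDim (s ∘ Fin.rev) l := blockDim_pos fun i => hs _
  have hadm := isAdmissible_one (F := F) (θ := θ) (s := s) hr hu hu0
  have hsign : ((-1 : K) ^ (r - 1)) * (-1) ^ (r - 1) = 1 := by
    rw [← mul_pow, neg_one_mul, neg_neg, one_pow]
  have h := (summable_sum_logRow_mul (u := u ∘ Fin.rev) hθ (fun i => hu _) hd
    (lastIdx_snd_add_one hr hd) rfl hadm.2).hasSum.mul_left ((-1) ^ (r - 1) : K)
  have hv : rhoPoint F θ s u 1 = specialPoint (s ∘ Fin.rev) (u ∘ Fin.rev) := by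
    rw [rhoPoint_eq, map_one, Module.End.one_apply]
  rw [Li_eq_of_isAdmissible hθ hr hd hu hadm, map_one, div_one, logSum]
  simpa only [hv, sum_logRow_mul_specialPoint hθ hr hd, ← mul_assoc ((-1 : K) ^ (r - 1)), hsign,
    one_mul] using h

theorem norm_liTerm_le {n : ℕ} {s : Fin (n + 1) → ℕ} {u : Fin (n + 1) → K} {b : ℝ} (hb : 1 ≤ b)
    (hL : ∀ k, ‖(bigL F θ k)⁻¹‖ ≤ b ^ k) (hu : ∀ i, ‖u i‖ ≤ 1)
    (i : {i : Fin (n + 1) → ℕ // Antitone i}) :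
    ‖liTerm F θ s u i‖ ≤ (b ^ ∑ e, s e) ^ i.1 0 * ‖u 0‖ ^ Fintype.card F ^ i.1 0 := by
  have hb0 : 0 ≤ b := by linarith
  rw [liTerm, norm_prod, Fin.prod_univ_succ, ← pow_mul, mul_comm _ (i.1 0), pow_mul,
    Fin.sum_univ_succ, pow_add]
  have h1 : ‖u 0 ^ Fintype.card F ^ i.1 0 / bigL F θ (i.1 0) ^ s 0‖ ≤
      ‖u 0‖ ^ Fintype.card F ^ i.1 0 * (b ^ i.1 0) ^ s 0 := by
    rw [div_eq_mul_inv, ← inv_pow, norm_mul, norm_pow, norm_pow]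
    gcongr
    exact hL _
  have h2 : ∏ e : Fin n, ‖u e.succ ^ Fintype.card F ^ i.1 e.succ /
      bigL F θ (i.1 e.succ) ^ s e.succ‖ ≤ (b ^ i.1 0) ^ ∑ e : Fin n, s e.succ := by
    rw [← Finset.prod_pow_eq_pow_sum]
    refine Finset.prod_le_prod (fun _ _ => norm_nonneg _) fun e _ => ?_
    refine (norm_liFactor_le (w := fun _ => u e.succ) (σ := fun _ => s e.succ) (e := 0) hL
      (hu _) _).trans ?_
    gcongr
    exact i.2 (Fin.zero_le _)
  calc _ ≤ _ := mul_le_mul h1 h2 (Finset.prod_nonneg fun _ _ => norm_nonneg _) (by positivity)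
    _ = _ := by ring

/-- In the convergent region, `Li⋆` is given by its power series. -/
theorem hasSum_liTerm (hθ : IsIntegralTheta F θ) (hr : 0 < r) (hs : ∀ i, 0 < s i)
    (hu : ∀ i, ‖u i‖ ≤ 1) (hu0 : ‖u ⟨0, hr⟩‖ < 1) : HasSum (liTerm F θ s u) (Li F θ s u) := by
  obtain ⟨n, rfl⟩ : ∃ n, r = n + 1 := ⟨r - 1, by omega⟩
  have h := hasSum_nestedSum_Li hθ hr hs hu hu0
  obtain ⟨b, hb, hL⟩ := hθ.exists_norm_inv_bigL_le
  have hb0 : 0 ≤ b := by linarith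
  rw [← (antitoneConsEquiv n).hasSum_iff]
  -- Group the tuples by their first index. The fibres are finite, so a bound depending only on that
  -- index and tending to zero gives summability over all tuples.
  refine HasSum.sigma_of_hasSum h (fun k => ?_) ?_
  · have hfib := (antitoneTuples n k).hasSum fun i =>
      u 0 ^ Fintype.card F ^ k / bigL F θ k ^ s 0 * ∏ e : Fin n,
        (u e.succ ^ Fintype.card F ^ i e / bigL F θ (i e) ^ s e.succ)
    rw [← Finset.mul_sum, sum_antitoneTuples_prod (revFactor F θ s u) n k
      (fun e j => u e.succ ^ Fintype.card F ^ j / bigL F θ j ^ s e.succ)] at hfib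
    · refine Eq.mp (congrArg (fun f => HasSum f _) (funext fun i => ?_)) hfib
      simp only [Function.comp_apply, liTerm, Fin.prod_univ_succ]
      rfl
    · intro e
      ext j
      have hval : ((e.rev : ℕ)) = (e.succ.rev : Fin (n + 1)) := by
        rw [Fin.val_rev, Fin.val_rev, Fin.val_succ]
        omega
      simp only [revFactor, liFactor]
      rw [hval, entry_val_add_one, entry_val_add_one, Function.comp_apply, Function.comp_apply,
        Fin.rev_rev]
  · refine NonarchimedeanAddGroup.summable_of_tendsto_cofinite_zero ?_
    have ht := (tendsto_pow_mul_pow_pow_atTop (B := b ^ ∑ e, s e) (by positivity)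
      (norm_nonneg (u 0)) hu0 (Fintype.one_lt_card (α := F)))
    rw [← Nat.cofinite_eq_atTop] at ht
    have hfst : Tendsto (Sigma.fst : (Σ k : ℕ, antitoneTuples n k) → ℕ) cofinite cofinite := by
      refine Tendsto.cofinite_of_finite_preimage_singleton fun k => ?_
      refine ((Set.finite_range fun i : antitoneTuples n k =>
        (⟨k, i⟩ : Σ k : ℕ, antitoneTuples n k))).subset ?_
      rintro ⟨k', i⟩ rfl
      exact ⟨i, rfl⟩
    exact squeeze_zero_norm (fun x => norm_liTerm_le hb hL hu _) (ht.comp hfst)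

end Li

end CMSPL

namespace CMSPL

/-! ### Merged indices and the differences of polylogarithms -/

section Merged

theorem entry_comp_rev {r : ℕ} {α : Type*} [Zero α] (x : Fin r → α) {e : ℕ} (he : e < r) :
    entry (x ∘ Fin.rev) (e + 1) = entry x (r - e) := by
  rw [entry, entry, dif_pos (by omega), dif_pos (by omega), Function.comp_apply]
  congr 1

theorem sum_entry_eq_sum_entry_rev {r : ℕ} (s : Fin r → ℕ) {i : ℕ} (hi : i ≤ r) :
    ∑ e ∈ Finset.Icc 1 i, entry s e =
      ∑ e ∈ Finset.Ico (r - i) r, entry (s ∘ Fin.rev) (e + 1) := by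
  refine Finset.sum_nbij' (fun e => r - e) (fun e => r - e) ?_ ?_ ?_ ?_ ?_
  · intro e he
    rw [Finset.mem_Icc] at he
    rw [Finset.mem_Ico]
    omega
  · intro e he
    rw [Finset.mem_Ico] at he
    rw [Finset.mem_Icc]
    omega
  · intro e he
    rw [Finset.mem_Icc] at he
    omega
  · intro e he
    rw [Finset.mem_Ico] at he
    omega
  · intro e he
    rw [Finset.mem_Icc] at he
    rw [entry_comp_rev s (by omega)]
    congr 1
    omega

theorem entry_pos {r : ℕ} {s : Fin r → ℕ} (hs : ∀ i, 0 < s i) {e : ℕ} (h1 : 1 ≤ e) (h2 : e ≤ r) :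
    0 < entry s e := by
  rw [entry, dif_pos ⟨h1, h2⟩]
  exact hs _

variable {F : Type*} [Field F] [Fintype F] {K : Type*} [NormedField K] [IsUltrametricDist K]
  [CompleteSpace K] [Algebra F K] {θ : K} {r : ℕ} {s : Fin r → ℕ} {u : Fin r → K}

theorem hasSum_Li_merged (hθ : IsIntegralTheta F θ) (hs : ∀ i, 0 < s i) (hu : ∀ i, ‖u i‖ ≤ 1)
    {i : ℕ} (hi1 : 1 ≤ i) (hi : i ≤ r) {z : K} (hz : ‖z‖ < 1) :
    HasSum (liTerm F θ (merged s i) (withHead z u i)) (Li F θ (merged s i) (withHead z u i)) ∧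
    HasSum (fun k => z ^ Fintype.card F ^ k /
      bigL F θ k ^ (∑ e ∈ Finset.Ico (r - i) r, entry (s ∘ Fin.rev) (e + 1)) *
        nestedSum (revFactor F θ s u) k (r - i)) (Li F θ (merged s i) (withHead z u i)) := by
  have hR : 0 < r + 1 - i := by omega
  have hs' : ∀ n, 0 < merged s i n := by
    intro n
    rw [merged]
    split_ifs
    · exact Finset.sum_pos (fun e he => entry_pos hs (Finset.mem_Icc.mp he).1
        ((Finset.mem_Icc.mp he).2.trans hi)) ⟨1, by simpa using hi1⟩
    · exact entry_pos hs (by omega) (by omega)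
  have hu' : ∀ n, ‖withHead z u i n‖ ≤ 1 := by
    intro n
    rw [withHead]
    split_ifs
    · exact hz.le
    · exact norm_entry_le hu _
  have hu0 : ‖withHead z u i ⟨0, hR⟩‖ < 1 := hz
  refine ⟨hasSum_liTerm hθ hR hs' hu' hu0, ?_⟩
  have h := hasSum_nestedSum_Li hθ hR hs' hu' hu0
  have h0 : merged s i ⟨0, hR⟩ = ∑ e ∈ Finset.Ico (r - i) r, entry (s ∘ Fin.rev) (e + 1) :=
    sum_entry_eq_sum_entry_rev s hi
  have h1 : r + 1 - i - 1 = r - i := by omega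
  -- Merging alters only the head, which is last after reversal, so the inner nested sum is that of
  -- the original tuples.
  have hcongr : ∀ e < r - i, revFactor F θ (merged s i) (withHead z u i) e =
      revFactor F θ s u e := by
    intro e he
    have hm : entry (merged s i ∘ Fin.rev) (e + 1) = entry (s ∘ Fin.rev) (e + 1) := by
      rw [entry_comp_rev _ (by omega), entry_comp_rev _ (by omega), entry, dif_pos (by omega),
        merged, if_neg (by dsimp only; omega)]
      congr 1
      dsimp only
      omega
    have hw : entry (withHead z u i ∘ Fin.rev) (e + 1) = entry (u ∘ Fin.rev) (e + 1) := by
      rw [entry_comp_rev _ (by omega), entry_comp_rev _ (by omega), entry, dif_pos (by omega),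
        withHead, if_neg (by dsimp only; omega)]
      congr 1
      dsimp only
      omega
    ext k
    simp only [revFactor, liFactor, hm, hw]
  have hz0 : withHead z u i ⟨0, hR⟩ = z := rfl
  rw [h0, h1, hz0] at h
  simpa only [nestedSum_congr hcongr] using h

/-- The difference of polylogarithms in the formula, as a series with strict first inequality. -/
theorem hasSum_Li_sub_Li (hθ : IsIntegralTheta F θ) (hs : ∀ i, 0 < s i) (hu : ∀ i, ‖u i‖ ≤ 1)
    (m : Fin r) {z : K} (hz : ‖z‖ < 1) (hz' : ‖z * entry u (r + 1 - m)‖ < 1) :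
    HasSum (fun k => z ^ Fintype.card F ^ k / bigL F θ k ^ blockDim (s ∘ Fin.rev) m *
        strictNestedSum (revFactor F θ s u) k m)
      (Li F θ (merged s (r - m)) (withHead z u (r - m)) -
        Li F θ (merged s (r + 1 - m)) (withHead (z * entry u (r + 1 - m)) u (r + 1 - m))) := by
  obtain ⟨m, hm⟩ := m
  have h1 := (hasSum_Li_merged hθ hs hu (i := r - m) (by omega) (by omega) hz).2
  rw [Nat.sub_sub_self hm.le] at h1
  rw [blockDim_eq_sum_entry]
  dsimp only at hz' ⊢
  cases m with
  | zero =>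
    rw [Li_of_eq_zero (s := merged s (r + 1 - 0)) (by omega), sub_zero]
    simpa only [strictNestedSum_zero, nestedSum_zero] using h1
  | succ m =>
    have h2 := (hasSum_Li_merged hθ hs hu (i := r + 1 - (m + 1)) (by omega) (by omega) hz').2
    have hrm : r - (r + 1 - (m + 1)) = m := by omega
    rw [hrm] at h2
    refine Eq.mp (congrArg (fun f => HasSum f _) (funext fun k => ?_)) (h1.sub h2)
    have hL0 := bigL_ne_zero hθ.pow_ne k
    have hentry : entry (u ∘ Fin.rev) (m + 1) = entry u (r + 1 - (m + 1)) := by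
      rw [entry_comp_rev u (by omega)]
      congr 1
      omega
    -- The diagonal term of the weak sum carries the factor `g m k`; its variable goes into `z` and
    -- its exponent joins the merged one, which is the second polylogarithm.
    rw [nestedSum_succ_eq_add, Finset.sum_eq_sum_Ico_succ_bot (by omega : m < r)
      (fun e => entry (s ∘ Fin.rev) (e + 1)), ← hentry, pow_add, mul_pow]
    simp only [revFactor, liFactor]
    field_simp
    ring

/-- One coordinate of the argument contributes a combination of polylogarithms to the logarithm. -/
theorem hasSum_logRow_mul_pow (hθ : IsIntegralTheta F θ) (hs : ∀ i, 0 < s i)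
    (hu : ∀ i, ‖u i‖ ≤ 1) (hr : 0 < r) (hd : ∀ l, 0 < blockDim (s ∘ Fin.rev) l) (m : Fin r)
    (j : Fin (blockDim (s ∘ Fin.rev) m)) {z : K} (hz : ‖z‖ < 1) :
    HasSum (fun k => logRow F θ (s ∘ Fin.rev) (u ∘ Fin.rev) (lastIdx (s ∘ Fin.rev) hr hd) k
        ⟨m, j.rev⟩ * z ^ Fintype.card F ^ k)
      (∑ l ∈ Finset.range ((j : ℕ) + 1),
        (-1) ^ ((j : ℕ) + l + m) * (Nat.choose j l : K) * θ ^ l *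
          (Li F θ (merged s (r - m)) (withHead (θ ^ ((j : ℕ) - l) * z) u (r - m)) -
            Li F θ (merged s (r + 1 - m))
              (withHead (θ ^ ((j : ℕ) - l) * z * entry u (r + 1 - m)) u (r + 1 - m)))) := by
  have hlt : ∀ n, ‖θ ^ n * z‖ < 1 := fun n => by
    rw [norm_mul, norm_pow]
    exact mul_lt_one_of_nonneg_of_lt_one_right (pow_le_one₀ (norm_nonneg _) hθ.norm_le_one)
      (norm_nonneg _) hz
  have hlt' : ∀ n, ‖θ ^ n * z * entry u (r + 1 - m)‖ < 1 := fun n => by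
    rw [norm_mul]
    exact mul_lt_one_of_nonneg_of_lt_one_left (norm_nonneg _) (hlt n) (norm_entry_le hu _)
  have h := hasSum_sum (s := Finset.range ((j : ℕ) + 1)) fun l _ =>
    (hasSum_Li_sub_Li hθ hs hu m (hlt ((j : ℕ) - l)) (hlt' ((j : ℕ) - l))).mul_left
      ((-1) ^ ((j : ℕ) + l + m) * (Nat.choose j l : K) * θ ^ l)
  refine Eq.mp (congrArg (fun f => HasSum f _) (funext fun k => ?_)) h
  rw [logRow_eq _ hθ.pow_ne hd (lastIdx_snd_add_one hr hd) rfl, Fin.rev_rev, sub_eq_add_neg,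
    add_pow, Finset.mul_sum, Finset.sum_div, Finset.sum_mul, Finset.sum_mul]
  refine Finset.sum_congr rfl fun l hl => ?_
  have hl' : l ≤ (j : ℕ) := Nat.lt_succ_iff.mp (Finset.mem_range.mp hl)
  have hsign : (-1 : K) ^ ((j : ℕ) + l + m) = (-1) ^ ((j : ℕ) - l) * (-1) ^ (m : ℕ) := by
    rw [← pow_add]
    have : (j : ℕ) + l + m = (j : ℕ) - l + m + 2 * l := by omega
    rw [this, pow_add _ _ (2 * l), pow_mul, neg_one_sq, one_pow, mul_one]
  -- The power `θ^(q^k (j-l))` is absorbed into the argument, giving `(θ^(j-l) z)^(q^k)`; the factor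
  -- `θ^l` does not depend on `k`.
  rw [hsign, mul_pow, neg_pow (θ ^ Fintype.card F ^ k), ← pow_mul, ← pow_mul,
    mul_comm ((j : ℕ) - l) (Fintype.card F ^ k)]
  ring

end Merged

end CMSPL

open FunctionFieldPlace in
theorem FunctionFieldPlace.isIntegralTheta_theta {F : Type*} [Field F] [Fintype F]
    (v : HeightOneSpectrum F[X]) : CMSPL.IsIntegralTheta F (theta v) :=
  ⟨norm_theta_le_one v, exists_le_norm_theta_sub v, transcendental_theta v⟩

end

/-! ### Assembly of the formula -/

open FunctionFieldPlace CMSPL in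
theorem theorem3 {F : Type*} [Field F] [Fintype F] (v : HeightOneSpectrum F[X])
    {r : ℕ} (hr : 0 < r) (s : Fin r → ℕ) (hs : ∀ i, 0 < s i)
    (u : Fin r → Cv v) (hu_alg : ∀ i, IsAlgebraic (RatFunc F) (u i)) (hu_ne : ∀ i, u i ≠ 0)
    (hu_le : ∀ i, ‖u i‖ ≤ 1)
    (a : F[X]) (ha : a ≠ 0)
    (V : Idx (s ∘ Fin.rev) → Cv v) (hV : V = rhoPoint F (theta v) s u a)
    (hV_lt : ∀ x, ‖V x‖ < 1) :
    (∀ x, IsAlgebraic (RatFunc F) (V x)) ∧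
    (∀ (m : Fin r) (j : Fin (blockDim (s ∘ Fin.rev) m)) (l : ℕ), l ≤ j →
      ‖theta v ^ ((j : ℕ) - l) * V ⟨m, j.rev⟩‖ < 1 ∧
      HasSum
        (liTerm F (theta v) (merged s (r - m))
          (withHead (theta v ^ ((j : ℕ) - l) * V ⟨m, j.rev⟩) u (r - m)))
        (Li F (theta v) (merged s (r - m))
          (withHead (theta v ^ ((j : ℕ) - l) * V ⟨m, j.rev⟩) u (r - m))) ∧
      (0 < (m : ℕ) →
        ‖theta v ^ ((j : ℕ) - l) * V ⟨m, j.rev⟩ * entry u (r + 1 - m)‖ < 1 ∧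
        HasSum
          (liTerm F (theta v) (merged s (r + 1 - m))
            (withHead (theta v ^ ((j : ℕ) - l) * V ⟨m, j.rev⟩ * entry u (r + 1 - m)) u
              (r + 1 - m)))
          (Li F (theta v) (merged s (r + 1 - m))
            (withHead (theta v ^ ((j : ℕ) - l) * V ⟨m, j.rev⟩ * entry u (r + 1 - m)) u
              (r + 1 - m))))) ∧
    Li F (theta v) s u =
      (-1) ^ (r - 1) / Polynomial.aeval (theta v) a *
        ∑ m : Fin r, ∑ j : Fin (blockDim (s ∘ Fin.rev) m), ∑ l ∈ Finset.range ((j : ℕ) + 1),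
          (-1) ^ ((j : ℕ) + l + m) * (Nat.choose j l : Cv v) * theta v ^ l *
            (Li F (theta v) (merged s (r - m))
                (withHead (theta v ^ ((j : ℕ) - l) * V ⟨m, j.rev⟩) u (r - m)) -
              Li F (theta v) (merged s (r + 1 - m))
                (withHead (theta v ^ ((j : ℕ) - l) * V ⟨m, j.rev⟩ * entry u (r + 1 - m)) u
                  (r + 1 - m))) := by
  have hθ := isIntegralTheta_theta v
  have hd : ∀ l, 0 < blockDim (s ∘ Fin.rev) l := blockDim_pos fun i => hs _
  refine ⟨fun x => ?_, fun m j l hl => ?_, ?_⟩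
  · let S : Subalgebra F (Cv v) :=
      (algebraicClosure (RatFunc F) (Cv v)).toSubalgebra.restrictScalars F
    have hS : ∀ y, y ∈ S ↔ IsAlgebraic (RatFunc F) y := fun y => mem_algebraicClosure_iff
    rw [hV, rhoPoint_eq]
    exact (hS _).mp (aeval_tAction_specialPoint_mem S
      ((hS _).mpr (isAlgebraic_algebraMap _)) (fun i => (hS _).mpr (hu_alg _)) a x)
  · have h1 : ‖theta v ^ ((j : ℕ) - l) * V ⟨m, j.rev⟩‖ < 1 := by
      rw [norm_mul, norm_pow]
      exact mul_lt_one_of_nonneg_of_lt_one_right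
        (pow_le_one₀ (norm_nonneg _) hθ.norm_le_one) (norm_nonneg _) (hV_lt _)
    have h2 : ‖theta v ^ ((j : ℕ) - l) * V ⟨m, j.rev⟩ * entry u (r + 1 - m)‖ < 1 := by
      rw [norm_mul]
      exact mul_lt_one_of_nonneg_of_lt_one_left (norm_nonneg _) h1 (norm_entry_le hu_le _)
    have hm := m.2
    exact ⟨h1, (hasSum_Li_merged hθ hs hu_le (by omega) (by omega) h1).1, fun hm0 =>
      ⟨h2, (hasSum_Li_merged hθ hs hu_le (by omega) (by omega) h2).1⟩⟩
  · have hadm : IsAdmissible F (theta v) s u a := ⟨ha, fun x => hV ▸ hV_lt x⟩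
    rw [Li_eq_of_isAdmissible hθ hr hd hu_le hadm, ← hV]
    congr 1
    have h := fun (m : Fin r) (j : Fin (blockDim (s ∘ Fin.rev) m)) =>
      hasSum_logRow_mul_pow hθ hs hu_le hr hd m j (hV_lt ⟨m, j.rev⟩)
    have hsum := hasSum_sum (s := Finset.univ) fun m _ =>
      hasSum_sum (s := Finset.univ) fun j _ => h m j
    rw [← hsum.tsum_eq, logSum]
    refine tsum_congr fun k => ?_
    rw [Fintype.sum_sigma]
    refine Finset.sum_congr rfl fun m _ => ?_
    -- The formula counts coordinates from the end of each block, the logarithm from its beginning.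
    exact (Equiv.sum_comp Fin.revPerm fun j => logRow F (theta v) (s ∘ Fin.rev) (u ∘ Fin.rev)
      (lastIdx (s ∘ Fin.rev) hr hd) k ⟨m, j⟩ * V ⟨m, j⟩ ^ Fintype.card F ^ k).symm
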